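/- **Setting.** Let $1<B<2$ and $0<\kappa<\frac{B^2}{4}\wedge\frac12$. For $i,j\in\mathbb N=\{1,2,\dots\}$ let $d(i,j)$ be the least $p\ge 0$ such that $i$ and $j$ lie in the same block $\{(k-1)2^p+1,\dots,k2^p\}$, $k\ge1$, and let $\omega=(\omega_i)_{i\in\mathbb N}$ be a centered Gaussian sequence with $\mathbb E[\omega_i\omega_j]=\kappa^{d(i,j)}$. For $\beta\ge 0$, $h\in\mathbb R$ put $Z_0^{(i)}=e^{\beta\omega_i+h}$ and $Z_{n+1}^{(i)}=\big(Z_n^{(2i-1)}Z_n^{(2i)}+B-1\big)/B$. The annealed partition function is $Z^{a}_{n,h}=\mathbb E[Z_n^{(1)}]$, the annealed free energy is $F^{a}(\beta,h)=\lim_{n\to\infty}2^{-n}\log Z^{a}_{n,h}$, and the annealed critical point is $h_c^a=h_c^a(\beta)=\sup\{h\in\mathbb R: F^{a}(\beta,h)=0\}$. Let $\mathbf E_n$ be the expectation for the Galton–Watson tree started from one individual in which each individual has no child with probability $\frac{B-1}{B}$ and two children with probability $\frac1B$. The positions at generation $n$ of the full binary tree are labelled $1,\dots,2^n$ from left to right;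 $\delta_i=1$ if individual $i$ is present at generation $n$ and $\delta_i=0$ otherwise, and $\delta_I=\prod_{i\in I}\delta_i$. The annealed Hamiltonian is $$H^{a}_{n,h}=h\sum_{k=1}^{2^n}\delta_k+\frac{\beta^2}{2}\sum_{i,j=1}^{2^n}\kappa^{d(i,j)}\delta_i\delta_j .$$ **Proposition 3.2.** There exist $\beta_0>0$, $c_1>0$ and $c_2>0$, depending only on $B$ and $\kappa$, such that for every $0\le\beta\le\beta_0$ and every $n\ge0$: 1. for every non-empty $I\subset\{1,\dots,2^n\}$, $$\big(e^{-c_1\beta^2}\big)^{|I|}\,\mathbf E_n[\delta_I]\;\le\;\mathbf E_n\big[\delta_I\,e^{H^{a}_{n,h_c^a}}\big]\;\le\;\big(e^{c_1\beta^2}\big)^{|I|}\,\mathbf E_n[\delta_I];$$ 2. $$e^{-c_2\beta^2(4\kappa/B^2)^n}\;\le\; Z^{a}_{n,h_c^a}\;\le\;1 .$$ -/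

import Mathlib

open MeasureTheory ProbabilityTheory Filter Topology

noncomputable section

namespace HierPinning

/-! Sites are numbered from `0`: site `i : ℕ` below is the site `i + 1` of `{1, 2, …}`, so that
`{1, …, 2 ^ n}` is `Finset.range (2 ^ n)`, and the blocks of size `2 ^ p` are the sets
`{k * 2 ^ p, …, (k + 1) * 2 ^ p - 1}`, `k : ℕ`. -/

/-- Hierarchical (tree) distance: the least `p` such that `i` and `j` lie in the same block of size
`2 ^ p`; the block of size `2 ^ p` that contains `i` is the one with number `i / 2 ^ p`. -/
def hierDist (i j : ℕ) : ℕ := sInf {p : ℕ | i / 2 ^ p = j / 2 ^ p}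

/-- The process `ω` is a sequence of jointly Gaussian, centered random variables with the
hierarchical correlations `𝔼[ω i * ω j] = κ ^ d(i, j)`. -/
structure IsHierDisorder {Ω : Type*} [MeasurableSpace Ω] (κ : ℝ) (P : Measure Ω)
    (ω : ℕ → Ω → ℝ) : Prop where
  gaussian : IsGaussianProcess ω P
  centered : ∀ i, ∫ x, ω i x ∂P = 0
  correlation : ∀ i j, ∫ x, ω i x * ω j x ∂P = κ ^ hierDist i j

/-- The quenched partition function `Z_n^{(i)}` of the `i`-th block of size `2 ^ n` in the
environment `w`:  `Z_0^{(i)} = exp (β w_i + h)` and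
`Z_{n+1}^{(i)} = (Z_n^{(2i)} Z_n^{(2i+1)} + B - 1) / B`. -/
def quenchedZ (B β h : ℝ) (w : ℕ → ℝ) : ℕ → ℕ → ℝ
  | 0, i => Real.exp (β * w i + h)
  | n + 1, i => (quenchedZ B β h w n (2 * i) * quenchedZ B β h w n (2 * i + 1) + (B - 1)) / B

/-- The annealed partition function `Z^a_{n,h} = 𝔼[Z^ω_{n,h}]` of the first block. -/
def annealedZ {Ω : Type*} [MeasurableSpace Ω] (P : Measure Ω) (ω : ℕ → Ω → ℝ) (B β : ℝ)
    (n : ℕ) (h : ℝ) : ℝ :=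
  ∫ x, quenchedZ B β h (fun i => ω i x) n 0 ∂P

/-- The annealed free energy `F^a(β, h) = lim 2 ^ (-n) log Z^a_{n,h}`. -/
def annealedF {Ω : Type*} [MeasurableSpace Ω] (P : Measure Ω) (ω : ℕ → Ω → ℝ) (B β h : ℝ) : ℝ :=
  limUnder atTop (fun n : ℕ => 1 / 2 ^ n * Real.log (annealedZ P ω B β n h))

/-- The annealed critical point `h_c^a(β)`: `F^a(β, ·)` vanishes up to `h_c^a(β)` and is positive
beyond it, so `h_c^a(β)` is the supremum of the `h` at which it vanishes. -/
def annealedHc {Ω : Type*} [MeasurableSpace Ω] (P : Measure Ω) (ω : ℕ → Ω → ℝ) (B β : ℝ) : ℝ :=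
  sSup {h : ℝ | annealedF P ω B β h = 0}

/-- The family trees with generations `0, …, n` in which every individual of a generation `< n` has
either no child (`none`) or two children (`some (s, t)`, with the trees `s` and `t` of
descendants of the two children). -/
def GWTree : ℕ → Type
  | 0 => Unit
  | n + 1 => Option (GWTree n × GWTree n)

instance instFintypeGWTree : (n : ℕ) → Fintype (GWTree n)
  | 0 => inferInstanceAs (Fintype Unit)
  | n + 1 =>
    letI := instFintypeGWTree n
    inferInstanceAs (Fintype (Option (GWTree n × GWTree n)))

/-- The Galton-Watson law on the family trees: independently, every individual of a generation `< n`
has no child with probability `(B - 1) / B` and two children with probability `1 / B`. -/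
def gwProb (B : ℝ) : (n : ℕ) → GWTree n → ℝ
  | 0, _ => 1
  | _ + 1, none => (B - 1) / B
  | n + 1, some (s, t) => 1 / B * (gwProb B n s * gwProb B n t)

/-- The expectation `E_n` with respect to the Galton-Watson law. -/
def gwE (B : ℝ) (n : ℕ) (f : GWTree n → ℝ) : ℝ := ∑ t, gwProb B n t * f t

/-- The set `R_n ⊆ {0, …, 2 ^ n - 1}` of the positions of the individuals of the tree that are
present at generation `n`. -/
def leaves : (n : ℕ) → GWTree n → Finset ℕ
  | 0, _ => {0}
  | _ + 1, none => ∅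
  | n + 1, some (s, t) => leaves n s ∪ (leaves n t).map (addRightEmbedding (2 ^ n))

/-- `δ_i = 1` if the individual `i` is present at generation `n`, and `δ_i = 0` otherwise. -/
def delta {n : ℕ} (t : GWTree n) (i : ℕ) : ℝ := if i ∈ leaves n t then 1 else 0

/-- `δ_I = ∏_{i ∈ I} δ_i`. -/
def deltaProd {n : ℕ} (t : GWTree n) (I : Finset ℕ) : ℝ := ∏ i ∈ I, delta t i

/-- The annealed Hamiltonian
`H^a_{n,h} = h ∑_k δ_k + (β² / 2) ∑_{i,j} κ ^ d(i,j) δ_i δ_j`, sums over all sites of the first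
block of size `2 ^ n` (the diagonal `i = j`, where `d = 0`, included). -/
def annealedH (κ β : ℝ) (n : ℕ) (h : ℝ) (t : GWTree n) : ℝ :=
  h * ∑ k ∈ Finset.range (2 ^ n), delta t k
    + β ^ 2 / 2 * ∑ i ∈ Finset.range (2 ^ n), ∑ j ∈ Finset.range (2 ^ n),
        κ ^ hierDist i j * delta t i * delta t j

end HierPinning

end

namespace HierPinning

/-! ### Binary family trees -/

/-- The only tree with a single generation. -/
def GWTree.root : GWTree 0 := (() : Unit)

/-- The tree whose root has no child. -/
def GWTree.dead (n : ℕ) : GWTree (n + 1) := (none : Option (GWTree n × GWTree n))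

/-- The tree whose root has two children, with the given trees of descendants. -/
def GWTree.node {n : ℕ} (s t : GWTree n) : GWTree (n + 1) := (some (s, t) : Option _)

/-- The number of individuals of the last generation. -/
noncomputable def numLeaves {n : ℕ} (t : GWTree n) : ℝ := (leaves n t).card

/-- The set of sites of a block of size `2 ^ (n + 1)` with the given left and right halves. -/
def glue (n : ℕ) (I J : Finset ℕ) : Finset ℕ := I ∪ J.map (addRightEmbedding (2 ^ n))

lemma leaves_dead (n : ℕ) : leaves (n + 1) (GWTree.dead n) = ∅ := rfl

lemma leaves_node {n : ℕ} (s t : GWTree n) :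
    leaves (n + 1) (GWTree.node s t) = glue n (leaves n s) (leaves n t) := rfl

lemma gwProb_dead (B : ℝ) (n : ℕ) : gwProb B (n + 1) (GWTree.dead n) = (B - 1) / B := rfl

lemma gwProb_node (B : ℝ) {n : ℕ} (s t : GWTree n) :
    gwProb B (n + 1) (GWTree.node s t) = 1 / B * (gwProb B n s * gwProb B n t) := rfl

lemma GWTree.cases_succ {n : ℕ} (t : GWTree (n + 1)) :
    t = GWTree.dead n ∨ ∃ s s', t = GWTree.node s s' := by
  match t with
  | none => exact Or.inl rfl
  | some (s, s') => exact Or.inr ⟨s, s', rfl⟩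

lemma glue_subset {n : ℕ} {I J : Finset ℕ} (hI : I ⊆ Finset.range (2 ^ n))
    (hJ : J ⊆ Finset.range (2 ^ n)) : glue n I J ⊆ Finset.range (2 ^ (n + 1)) := by
  intro x hx
  simp only [glue, Finset.mem_union, Finset.mem_map, addRightEmbedding_apply] at hx
  rw [Finset.mem_range, pow_succ]
  rcases hx with hx | ⟨y, hy, rfl⟩
  · have := Finset.mem_range.1 (hI hx); omega
  · have := Finset.mem_range.1 (hJ hy); omega

lemma leaves_subset : ∀ (n : ℕ) (t : GWTree n), leaves n t ⊆ Finset.range (2 ^ n)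
  | 0, _ => by simp [leaves]
  | n + 1, t => by
    rcases t.cases_succ with rfl | ⟨s, s', rfl⟩
    · simp [leaves_dead]
    · exact glue_subset (leaves_subset n s) (leaves_subset n s')

lemma disjoint_glue {n : ℕ} {I J : Finset ℕ} (hI : I ⊆ Finset.range (2 ^ n)) :
    Disjoint I (J.map (addRightEmbedding (2 ^ n))) := by
  rw [Finset.disjoint_left]
  intro x hx hx'
  simp only [Finset.mem_map, addRightEmbedding_apply] at hx'
  obtain ⟨y, -, rfl⟩ := hx'
  have := Finset.mem_range.1 (hI hx); omega

lemma card_glue {n : ℕ} {I J : Finset ℕ} (hI : I ⊆ Finset.range (2 ^ n)) :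
    (glue n I J).card = I.card + J.card := by
  rw [glue, Finset.card_union_of_disjoint (disjoint_glue hI), Finset.card_map]

lemma sum_glue {n : ℕ} {I J : Finset ℕ} (hI : I ⊆ Finset.range (2 ^ n)) (f : ℕ → ℝ) :
    ∑ i ∈ glue n I J, f i = ∑ i ∈ I, f i + ∑ j ∈ J, f (j + 2 ^ n) := by
  rw [glue, Finset.sum_union (disjoint_glue hI), Finset.sum_map]
  rfl

lemma exists_eq_glue {n : ℕ} {I : Finset ℕ} (hI : I ⊆ Finset.range (2 ^ (n + 1))) :
    ∃ J ⊆ Finset.range (2 ^ n), ∃ K ⊆ Finset.range (2 ^ n), I = glue n J K := by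
  refine ⟨I.filter (· < 2 ^ n), ?_, (Finset.range (2 ^ n)).filter (fun j => j + 2 ^ n ∈ I),
    Finset.filter_subset _ _, ?_⟩
  · intro x hx
    exact Finset.mem_range.2 (Finset.mem_filter.1 hx).2
  · ext x
    simp only [glue, Finset.mem_union, Finset.mem_map, addRightEmbedding_apply, Finset.mem_filter,
      Finset.mem_range]
    constructor
    · intro hx
      by_cases h : x < 2 ^ n
      · exact Or.inl ⟨hx, h⟩
      · have := Finset.mem_range.1 (hI hx)
        rw [pow_succ] at this
        refine Or.inr ⟨x - 2 ^ n, ⟨by omega, ?_⟩, by omega⟩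
        rwa [Nat.sub_add_cancel (by omega)]
    · rintro (⟨hx, -⟩ | ⟨y, ⟨-, hy⟩, rfl⟩)
      · exact hx
      · exact hy

lemma glue_subset_glue_iff {n : ℕ} {I J K L : Finset ℕ} (hI : I ⊆ Finset.range (2 ^ n))
    (hK : K ⊆ Finset.range (2 ^ n)) :
    glue n I J ⊆ glue n K L ↔ I ⊆ K ∧ J ⊆ L := by
  constructor
  · intro h
    refine ⟨fun x hx => ?_, fun x hx => ?_⟩
    · have hx' := h (Finset.mem_union_left _ hx)
      simp only [glue, Finset.mem_union, Finset.mem_map, addRightEmbedding_apply] at hx'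
      rcases hx' with h' | ⟨y, -, rfl⟩
      · exact h'
      · have := Finset.mem_range.1 (hI hx); omega
    · have hx' := h (Finset.mem_union_right _ (Finset.mem_map_of_mem _ hx))
      simp only [glue, Finset.mem_union, Finset.mem_map, addRightEmbedding_apply] at hx'
      rcases hx' with h' | ⟨y, hy, h'⟩
      · have := Finset.mem_range.1 (hK h'); omega
      · obtain rfl : y = x := by omega
        exact hy
  · rintro ⟨h1, h2⟩
    exact Finset.union_subset_union h1 (Finset.map_subset_map.2 h2)

lemma deltaProd_eq {n : ℕ} (t : GWTree n) (I : Finset ℕ) :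
    deltaProd t I = if I ⊆ leaves n t then 1 else 0 := by
  classical
  unfold deltaProd delta
  rw [Finset.prod_ite_zero]
  simp [Finset.subset_iff]

lemma deltaProd_empty {n : ℕ} (t : GWTree n) : deltaProd t ∅ = 1 := by simp [deltaProd]

lemma deltaProd_singleton {n : ℕ} (t : GWTree n) (i : ℕ) : deltaProd t {i} = delta t i := by
  simp [deltaProd]

lemma deltaProd_nonneg {n : ℕ} (t : GWTree n) (I : Finset ℕ) : 0 ≤ deltaProd t I := by
  rw [deltaProd_eq]; split_ifs <;> norm_num

lemma deltaProd_mul {n : ℕ} (t : GWTree n) (I J : Finset ℕ) :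
    deltaProd t I * deltaProd t J = deltaProd t (I ∪ J) := by
  simp only [deltaProd_eq, Finset.union_subset_iff]
  split_ifs <;> simp_all

lemma deltaProd_dead {n : ℕ} {I : Finset ℕ} (hI : I.Nonempty) :
    deltaProd (GWTree.dead n) I = 0 := by
  rw [deltaProd_eq, leaves_dead, if_neg]
  rw [Finset.subset_empty]; exact hI.ne_empty

lemma deltaProd_node {n : ℕ} {I J : Finset ℕ} (hI : I ⊆ Finset.range (2 ^ n)) (s t : GWTree n) :
    deltaProd (GWTree.node s t) (glue n I J) = deltaProd s I * deltaProd t J := by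
  simp only [deltaProd_eq, leaves_node, glue_subset_glue_iff hI (leaves_subset n s)]
  split_ifs <;> simp_all

lemma sum_delta {n : ℕ} (t : GWTree n) (f : ℕ → ℝ) :
    ∑ i ∈ Finset.range (2 ^ n), f i * delta t i = ∑ i ∈ leaves n t, f i := by
  simp only [delta, mul_ite, mul_one, mul_zero]
  rw [← Finset.sum_filter]
  congr 1
  ext i
  simp only [Finset.mem_filter]
  exact ⟨fun h => h.2, fun h => ⟨leaves_subset n t h, h⟩⟩

lemma numLeaves_eq_sum {n : ℕ} (t : GWTree n) :
    numLeaves t = ∑ i ∈ Finset.range (2 ^ n), delta t i := by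
  have := sum_delta t (fun _ => 1)
  simp only [one_mul] at this
  simp [this, numLeaves]

lemma numLeaves_nonneg {n : ℕ} (t : GWTree n) : 0 ≤ numLeaves t := Nat.cast_nonneg _

lemma numLeaves_le {n : ℕ} (t : GWTree n) : numLeaves t ≤ 2 ^ n := by
  have := Finset.card_le_card (leaves_subset n t)
  rw [Finset.card_range] at this
  unfold numLeaves
  exact_mod_cast this

lemma numLeaves_zero (t : GWTree 0) : numLeaves t = 1 := by simp [numLeaves, leaves]

lemma numLeaves_dead (n : ℕ) : numLeaves (GWTree.dead n) = 0 := by simp [numLeaves, leaves_dead]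

lemma numLeaves_node {n : ℕ} (s t : GWTree n) :
    numLeaves (GWTree.node s t) = numLeaves s + numLeaves t := by
  rw [numLeaves, leaves_node, card_glue (leaves_subset n s)]
  push_cast; rfl

/-! ### Expectations under the Galton-Watson law -/

lemma gwE_zero (B : ℝ) (f : GWTree 0 → ℝ) : gwE B 0 f = f GWTree.root := by
  change ∑ t : Unit, gwProb B 0 t * f t = _
  rw [Fintype.sum_unique]
  exact one_mul _

lemma gwE_succ (B : ℝ) (n : ℕ) (f : GWTree (n + 1) → ℝ) :
    gwE B (n + 1) f = (B - 1) / B * f (GWTree.dead n)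
      + 1 / B * gwE B n (fun s => gwE B n (fun t => f (GWTree.node s t))) := by
  have h : gwE B (n + 1) f = ∑ t : Option (GWTree n × GWTree n), gwProb B (n + 1) t * f t := rfl
  rw [h, Fintype.sum_option, Fintype.sum_prod_type]
  congr 1
  simp only [gwE, Finset.mul_sum]
  refine Finset.sum_congr rfl fun s _ => Finset.sum_congr rfl fun t _ => ?_
  change 1 / B * (gwProb B n s * gwProb B n t) * f (GWTree.node s t) = _
  ring

lemma gwE_const_mul (B : ℝ) (n : ℕ) (c : ℝ) (f : GWTree n → ℝ) :
    gwE B n (fun t => c * f t) = c * gwE B n f := by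
  simp only [gwE, Finset.mul_sum]
  exact Finset.sum_congr rfl fun t _ => by ring

lemma gwE_mul_const (B : ℝ) (n : ℕ) (c : ℝ) (f : GWTree n → ℝ) :
    gwE B n (fun t => f t * c) = gwE B n f * c := by
  simp only [gwE, Finset.sum_mul]
  exact Finset.sum_congr rfl fun t _ => by ring

lemma gwE_add (B : ℝ) (n : ℕ) (f g : GWTree n → ℝ) :
    gwE B n (fun t => f t + g t) = gwE B n f + gwE B n g := by
  simp only [gwE, mul_add, Finset.sum_add_distrib]

lemma gwE_sum {ι : Type*} (B : ℝ) (n : ℕ) (s : Finset ι) (f : ι → GWTree n → ℝ) :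
    gwE B n (fun t => ∑ i ∈ s, f i t) = ∑ i ∈ s, gwE B n (f i) := by
  simp only [gwE, Finset.mul_sum]
  exact Finset.sum_comm

lemma gwE_comm (B : ℝ) (n : ℕ) (f : GWTree n → GWTree n → ℝ) :
    gwE B n (fun s => gwE B n (fun t => f s t)) = gwE B n (fun t => gwE B n (fun s => f s t)) := by
  simp only [gwE, Finset.mul_sum]
  rw [Finset.sum_comm]
  exact Finset.sum_congr rfl fun _ _ => Finset.sum_congr rfl fun _ _ => by ring

lemma gwE_mul_gwE (B : ℝ) (n : ℕ) (f g : GWTree n → ℝ) :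
    gwE B n (fun s => gwE B n (fun t => f s * g t)) = gwE B n f * gwE B n g := by
  simp only [gwE_const_mul, gwE_mul_const]

lemma gwProb_nonneg {B : ℝ} (hB : 1 ≤ B) : ∀ (n : ℕ) (t : GWTree n), 0 ≤ gwProb B n t
  | 0, _ => by simp [gwProb]
  | n + 1, t => by
    rcases t.cases_succ with rfl | ⟨s, s', rfl⟩
    · rw [gwProb_dead]; exact div_nonneg (by linarith) (by linarith)
    · rw [gwProb_node]
      have := gwProb_nonneg hB n s
      have := gwProb_nonneg hB n s'
      positivity

lemma gwE_mono {B : ℝ} (hB : 1 ≤ B) {n : ℕ} {f g : GWTree n → ℝ} (h : ∀ t, f t ≤ g t) :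
    gwE B n f ≤ gwE B n g :=
  Finset.sum_le_sum fun t _ => mul_le_mul_of_nonneg_left (h t) (gwProb_nonneg hB n t)

lemma gwE_nonneg {B : ℝ} (hB : 1 ≤ B) {n : ℕ} {f : GWTree n → ℝ} (h : ∀ t, 0 ≤ f t) :
    0 ≤ gwE B n f :=
  Finset.sum_nonneg fun t _ => mul_nonneg (gwProb_nonneg hB n t) (h t)

lemma gwE_const {B : ℝ} (hB : 1 ≤ B) (c : ℝ) (n : ℕ) : gwE B n (fun _ => c) = c := by
  induction n with
  | zero => rw [gwE_zero]
  | succ n ih =>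
    have : B ≠ 0 := by linarith
    rw [gwE_succ, ih, ih]; field_simp; ring

lemma gwE_succ_deltaProd_mul (B : ℝ) {n : ℕ} {I J : Finset ℕ} (hI : I ⊆ Finset.range (2 ^ n))
    (hne : (glue n I J).Nonempty) (f : GWTree (n + 1) → ℝ) :
    gwE B (n + 1) (fun t => deltaProd t (glue n I J) * f t)
      = 1 / B * gwE B n (fun s => gwE B n (fun t =>
          deltaProd s I * deltaProd t J * f (GWTree.node s t))) := by
  rw [gwE_succ, deltaProd_dead hne]
  simp only [deltaProd_node hI]
  ring

lemma gwE_succ_deltaProd (B : ℝ) {n : ℕ} {I J : Finset ℕ} (hI : I ⊆ Finset.range (2 ^ n))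
    (hne : (glue n I J).Nonempty) :
    gwE B (n + 1) (fun t => deltaProd t (glue n I J))
      = 1 / B * (gwE B n (fun s => deltaProd s I) * gwE B n (fun t => deltaProd t J)) := by
  have := gwE_succ_deltaProd_mul B hI hne (fun _ => 1)
  simp only [mul_one] at this
  rw [this, gwE_mul_gwE]

lemma gwE_numLeaves {B : ℝ} (hB : 1 ≤ B) (n : ℕ) : gwE B n numLeaves = (2 / B) ^ n := by
  induction n with
  | zero => rw [gwE_zero, numLeaves_zero]; simp
  | succ n ih =>
    rw [gwE_succ, numLeaves_dead]
    simp only [numLeaves_node, gwE_add, gwE_const hB]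
    rw [ih]
    ring

/-! ### Exponential moments of quadratic type -/

lemma exp_le_self_add_exp_sq (y : ℝ) : Real.exp y ≤ y + Real.exp (y ^ 2) := by
  have h1 := Real.add_one_le_exp (y ^ 2)
  rcases le_or_gt |y| 1 with h | h
  · have := (abs_le.1 (Real.abs_exp_sub_one_sub_id_le h)).2
    linarith
  · rcases lt_abs.1 h with h | h
    · have : Real.exp y ≤ Real.exp (y ^ 2) := Real.exp_le_exp.2 (by nlinarith)
      linarith
    · have : Real.exp y ≤ 1 := Real.exp_le_one_iff.2 (by linarith)
      nlinarith

/-- A crude form of Hoeffding's lemma for Bernoulli variables. -/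
lemma bernoulli_mgf_le {p : ℝ} (h0 : 0 ≤ p) (h1 : p ≤ 1) (y : ℝ) :
    (1 - p) + p * Real.exp y ≤ Real.exp (p * y + y ^ 2) := by
  have ha := exp_le_self_add_exp_sq (-(p * y))
  have hb := exp_le_self_add_exp_sq ((1 - p) * y)
  have ha' : Real.exp ((-(p * y)) ^ 2) ≤ Real.exp (y ^ 2) := by
    apply Real.exp_le_exp.2
    nlinarith [mul_nonneg (mul_nonneg (sub_nonneg.2 h1) (by linarith : 0 ≤ 1 + p)) (sq_nonneg y)]
  have hb' : Real.exp (((1 - p) * y) ^ 2) ≤ Real.exp (y ^ 2) := by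
    apply Real.exp_le_exp.2
    nlinarith [mul_nonneg (mul_nonneg h0 (by linarith : 0 ≤ 2 - p)) (sq_nonneg y)]
  have key : (1 - p) * Real.exp (-(p * y)) + p * Real.exp ((1 - p) * y) ≤ Real.exp (y ^ 2) := by
    have e1 := mul_le_mul_of_nonneg_left (ha.trans (add_le_add_right ha' _)) (sub_nonneg.2 h1)
    have e2 := mul_le_mul_of_nonneg_left (hb.trans (add_le_add_right hb' _)) h0
    linarith
  have h3 : (1 - p) + p * Real.exp y
      = Real.exp (p * y) * ((1 - p) * Real.exp (-(p * y)) + p * Real.exp ((1 - p) * y)) := by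
    have e1 : Real.exp (p * y) * Real.exp (-(p * y)) = 1 := by rw [← Real.exp_add]; simp
    have e2 : Real.exp (p * y) * Real.exp ((1 - p) * y) = Real.exp y := by
      rw [← Real.exp_add]; ring_nf
    linear_combination (-(1 - p)) * e1 - p * e2
  rw [h3, Real.exp_add]
  exact mul_le_mul_of_nonneg_left key (Real.exp_pos _).le

lemma exp_linear_sub_quadratic {c : ℝ} (hc : 0 < c) (a x : ℝ) :
    Real.exp (a * x - c * x ^ 2)
      = Real.exp (a ^ 2 / (4 * c)) * Real.exp (-c * (x - a / (2 * c)) ^ 2) := by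
  rw [← Real.exp_add]
  congr 1
  field_simp
  ring

lemma gaussianReal_exp_density (a b x : ℝ) :
    gaussianPDFReal 0 1 x • Real.exp (a * x + b * x ^ 2)
      = (√(2 * Real.pi))⁻¹ * Real.exp (a * x - (1 / 2 - b) * x ^ 2) := by
  simp only [gaussianPDFReal, NNReal.coe_one, smul_eq_mul, mul_one, sub_zero]
  rw [mul_assoc, ← Real.exp_add]
  congr 2
  ring

lemma integrable_gaussianReal_exp_quadratic {b : ℝ} (hb : b < 1 / 2) (a : ℝ) :
    Integrable (fun x => Real.exp (a * x + b * x ^ 2)) (gaussianReal 0 1) := by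
  rw [gaussianReal_of_var_ne_zero _ one_ne_zero,
    integrable_withDensity_iff_integrable_smul₀' (by fun_prop)
      (Filter.Eventually.of_forall fun x => gaussianPDF_lt_top)]
  simp only [toReal_gaussianPDF, gaussianReal_exp_density,
    exp_linear_sub_quadratic (by linarith : 0 < 1 / 2 - b)]
  exact (((integrable_exp_neg_mul_sq (by linarith)).comp_sub_right _).const_mul _).const_mul _

lemma integral_gaussianReal_exp_quadratic_le {b : ℝ} (h0 : 0 ≤ b) (hb : b ≤ 1 / 4) (a : ℝ) :
    ∫ x, Real.exp (a * x + b * x ^ 2) ∂(gaussianReal 0 1) ≤ Real.exp (2 * b + a ^ 2) := by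
  have hc : 0 < 1 / 2 - b := by linarith
  rw [integral_gaussianReal_eq_integral_smul one_ne_zero]
  simp only [gaussianReal_exp_density, exp_linear_sub_quadratic hc]
  rw [integral_const_mul, integral_const_mul,
    integral_sub_right_eq_self (fun x => Real.exp (-(1 / 2 - b) * x ^ 2)), integral_gaussian]
  have h1 : (√(2 * Real.pi))⁻¹ * √(Real.pi / (1 / 2 - b)) ≤ Real.exp (2 * b) := by
    rw [← Real.sqrt_inv, ← Real.sqrt_mul (by positivity)]
    apply Real.sqrt_le_iff.2 ⟨(Real.exp_pos _).le, ?_⟩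
    have h2 : (2 * Real.pi)⁻¹ * (Real.pi / (1 / 2 - b)) = 1 / (1 - 2 * b) := by
      have : (1 : ℝ) - 2 * b ≠ 0 := by linarith
      have : (1 : ℝ) / 2 - b ≠ 0 := by linarith
      field_simp
    have h3 := Real.add_one_le_exp (4 * b)
    rw [h2, div_le_iff₀ (by linarith), ← Real.exp_nat_mul]
    have h4 : ((2 : ℕ) : ℝ) * (2 * b) = 4 * b := by push_cast; ring
    rw [h4]
    nlinarith
  have h2 : Real.exp (a ^ 2 / (4 * (1 / 2 - b))) ≤ Real.exp (a ^ 2) := by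
    apply Real.exp_le_exp.2
    rw [div_le_iff₀ (by linarith)]
    nlinarith [sq_nonneg a]
  calc _ = ((√(2 * Real.pi))⁻¹ * √(Real.pi / (1 / 2 - b)))
        * Real.exp (a ^ 2 / (4 * (1 / 2 - b))) := by ring
    _ ≤ Real.exp (2 * b) * Real.exp (a ^ 2) := by gcongr
    _ = _ := (Real.exp_add _ _).symm

lemma integral_gaussianReal_exp_linear (s : ℝ) :
    ∫ x, Real.exp (s * x) ∂(gaussianReal 0 1) = Real.exp (s ^ 2 / 2) := by
  have := congrFun (mgf_fun_id_gaussianReal (μ := 0) (v := 1)) s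
  simpa [mgf] using this

/-- Linearization of a square: a quadratic bound on a cumulant generating function controls the
exponential moments of the square. -/
lemma sum_mul_exp_sq_le {ι : Type*} [Fintype ι] (w N : ι → ℝ) {M A D t : ℝ} (hM : 0 ≤ M)
    (hD : 0 ≤ D) (h : ∀ s, ∑ i, w i * Real.exp (s * N i) ≤ M * Real.exp (A * s + D * s ^ 2))
    (ht : 0 ≤ t) (htD : t * D ≤ 1 / 8) :
    ∑ i, w i * Real.exp (t * N i ^ 2) ≤ M * Real.exp (4 * t * D + 2 * t * A ^ 2) := by
  have hr : √(2 * t) ^ 2 = 2 * t := Real.sq_sqrt (by linarith)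
  have hlin : ∀ s, Integrable (fun x => Real.exp (s * x)) (gaussianReal 0 1) := fun s => by
    simpa using integrable_gaussianReal_exp_quadratic (b := 0) (by norm_num) s
  have h1 : ∑ i, w i * Real.exp (t * N i ^ 2)
      = ∫ x, ∑ i, w i * Real.exp (√(2 * t) * N i * x) ∂(gaussianReal 0 1) := by
    rw [integral_finsetSum _ fun i _ => (hlin _).const_mul _]
    refine Finset.sum_congr rfl fun i _ => ?_
    rw [integral_const_mul, integral_gaussianReal_exp_linear, mul_pow, hr]
    ring_nf
  have h2 : ∀ x, ∑ i, w i * Real.exp (√(2 * t) * N i * x)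
      ≤ M * Real.exp (√(2 * t) * A * x + 2 * t * D * x ^ 2) := fun x => by
    have := h (√(2 * t) * x)
    have e : A * (√(2 * t) * x) + D * (√(2 * t) * x) ^ 2
        = √(2 * t) * A * x + 2 * t * D * x ^ 2 := by rw [mul_pow, hr]; ring
    rw [e] at this
    simpa only [mul_right_comm] using this
  rw [h1]
  calc _ ≤ ∫ x, M * Real.exp (√(2 * t) * A * x + 2 * t * D * x ^ 2) ∂(gaussianReal 0 1) :=
        integral_mono (integrable_finsetSum _ fun i _ => (hlin _).const_mul _)
          ((integrable_gaussianReal_exp_quadratic (by linarith) _).const_mul _) h2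
    _ = M * ∫ x, Real.exp (√(2 * t) * A * x + 2 * t * D * x ^ 2) ∂(gaussianReal 0 1) :=
        integral_const_mul _ _
    _ ≤ M * Real.exp (2 * (2 * t * D) + (√(2 * t) * A) ^ 2) :=
        mul_le_mul_of_nonneg_left
          (integral_gaussianReal_exp_quadratic_le (by positivity) (by linarith) _) hM
    _ = _ := by rw [mul_pow, hr]; ring_nf

/-! ### The number of leaves under the Galton-Watson law -/

/-- A variance proxy for the number of individuals at generation `n`. -/
noncomputable def varProxy (B : ℝ) : ℕ → ℝ
  | 0 => 1
  | n + 1 => 2 * varProxy B n + 4 * ((2 / B) ^ n) ^ 2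

lemma varProxy_pos {B : ℝ} : ∀ n, 0 < varProxy B n
  | 0 => one_pos
  | n + 1 => by
    have := varProxy_pos (B := B) n
    rw [varProxy]; positivity

lemma sq_mean_le_varProxy {B : ℝ} (hB : 1 ≤ B) (n : ℕ) : ((2 / B) ^ n) ^ 2 ≤ varProxy B n := by
  cases n with
  | zero => simp [varProxy]
  | succ n =>
    have h1 : (2 / B) ^ 2 ≤ 4 := by
      have h : 2 / B ≤ 2 := div_le_self (by norm_num) hB
      have : 0 ≤ 2 / B := by positivity
      nlinarith
    rw [varProxy, pow_succ (2 / B) n, mul_pow]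
    nlinarith [varProxy_pos (B := B) n, sq_nonneg ((2 / B) ^ n)]

lemma gwE_exp_numLeaves_le {B : ℝ} (hB : 1 ≤ B) (n : ℕ) (s : ℝ) :
    gwE B n (fun t => Real.exp (s * numLeaves t))
      ≤ Real.exp ((2 / B) ^ n * s + varProxy B n * s ^ 2) := by
  induction n with
  | zero =>
    rw [gwE_zero, numLeaves_zero, varProxy]
    exact Real.exp_le_exp.2 (by nlinarith [sq_nonneg s])
  | succ n ih =>
    set a := (2 / B) ^ n with ha
    set D := varProxy B n with hD
    have hD0 : 0 < D := varProxy_pos n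
    have hB0 : 0 < B := by linarith
    have h0 : 0 ≤ gwE B n (fun t => Real.exp (s * numLeaves t)) :=
      gwE_nonneg hB fun t => (Real.exp_pos _).le
    rw [gwE_succ]
    simp only [numLeaves_dead, numLeaves_node, mul_add, Real.exp_add]
    rw [gwE_mul_gwE, mul_zero, Real.exp_zero]
    have h1 : gwE B n (fun t => Real.exp (s * numLeaves t))
        * gwE B n (fun t => Real.exp (s * numLeaves t))
        ≤ Real.exp (2 * D * s ^ 2) * Real.exp (2 * a * s) := by
      refine (mul_le_mul ih ih h0 (Real.exp_pos _).le).trans (le_of_eq ?_)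
      rw [← Real.exp_add, ← Real.exp_add]; ring_nf
    have h2 : 1 ≤ Real.exp (2 * D * s ^ 2) := Real.one_le_exp (by positivity)
    have h3 := bernoulli_mgf_le (p := 1 / B) (by positivity) ((div_le_one hB0).2 hB) (2 * a * s)
    have h4 : (B - 1) / B = 1 - 1 / B := by field_simp
    have h5 : 0 ≤ 1 - 1 / B := by rw [← h4]; exact div_nonneg (by linarith) hB0.le
    have h6 : (1 - 1 / B) * 1 ≤ (1 - 1 / B) * Real.exp (2 * D * s ^ 2) := by gcongr
    rw [h4]
    calc _ ≤ (1 - 1 / B) * Real.exp (2 * D * s ^ 2)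
          + 1 / B * (Real.exp (2 * D * s ^ 2) * Real.exp (2 * a * s)) := by gcongr
      _ = Real.exp (2 * D * s ^ 2) * ((1 - 1 / B) + 1 / B * Real.exp (2 * a * s)) := by ring
      _ ≤ Real.exp (2 * D * s ^ 2) * Real.exp (1 / B * (2 * a * s) + (2 * a * s) ^ 2) := by gcongr
      _ = _ := by
        rw [← Real.exp_add, ← Real.exp_add, varProxy, pow_succ (2 / B) n, ← ha, ← hD]
        congr 1
        ring

lemma gwE_deltaProd_nonneg {B : ℝ} (hB : 1 ≤ B) {n : ℕ} (I : Finset ℕ) :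
    0 ≤ gwE B n (fun t => deltaProd t I) := gwE_nonneg hB fun t => deltaProd_nonneg t I

lemma glue_nonempty_iff {n : ℕ} {I J : Finset ℕ} (hI : I ⊆ Finset.range (2 ^ n)) :
    (glue n I J).Nonempty ↔ I.Nonempty ∨ J.Nonempty := by
  simp only [← Finset.card_pos, card_glue hI]
  omega

lemma exists_gwE_deltaProd_mul_exp_le {B : ℝ} (hB : 1 ≤ B) (n : ℕ) {I : Finset ℕ}
    (hI : I ⊆ Finset.range (2 ^ n)) :
    ∃ A, 0 ≤ A ∧ A ^ 2 ≤ max (I.card : ℝ) 1 * varProxy B n ∧ ∀ s : ℝ,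
      gwE B n (fun t => deltaProd t I * Real.exp (s * numLeaves t))
        ≤ gwE B n (fun t => deltaProd t I) * Real.exp (A * s + varProxy B n * s ^ 2) := by
  induction n generalizing I with
  | zero =>
    refine ⟨1, zero_le_one, by simp [varProxy], fun s => ?_⟩
    simp only [gwE_zero, numLeaves_zero, varProxy]
    refine mul_le_mul_of_nonneg_left (Real.exp_le_exp.2 ?_) (deltaProd_nonneg _ _)
    nlinarith [sq_nonneg s]
  | succ n ih =>
    obtain ⟨J, hJ, K, hK, rfl⟩ := exists_eq_glue hI
    rcases (glue n J K).eq_empty_or_nonempty with h | hne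
    · refine ⟨(2 / B) ^ (n + 1), by positivity, ?_, fun s => ?_⟩
      · simpa [h] using sq_mean_le_varProxy hB (n + 1)
      · simpa [h, deltaProd_empty, gwE_const hB] using gwE_exp_numLeaves_le hB (n + 1) s
    have hD := varProxy_pos (B := B) n
    have hempty : ∀ s : ℝ, gwE B n (fun t => deltaProd t ∅ * Real.exp (s * numLeaves t))
        ≤ gwE B n (fun t => deltaProd t ∅)
          * Real.exp ((2 / B) ^ n * s + varProxy B n * s ^ 2) := fun s => by
      simpa [deltaProd_empty, gwE_const hB] using gwE_exp_numLeaves_le hB n s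
    obtain ⟨a, b, ha0, hb0, hab, ha, hb⟩ : ∃ a b, 0 ≤ a ∧ 0 ≤ b ∧
        (a + b) ^ 2 ≤ max ((glue n J K).card : ℝ) 1 * varProxy B (n + 1) ∧
        (∀ s : ℝ, gwE B n (fun t => deltaProd t J * Real.exp (s * numLeaves t))
          ≤ gwE B n (fun t => deltaProd t J) * Real.exp (a * s + varProxy B n * s ^ 2)) ∧
        (∀ s : ℝ, gwE B n (fun t => deltaProd t K * Real.exp (s * numLeaves t))
          ≤ gwE B n (fun t => deltaProd t K) * Real.exp (b * s + varProxy B n * s ^ 2)) := by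
      have hp : 0 ≤ (2 / B) ^ n := by positivity
      obtain ⟨a, ha0, haD, ha⟩ := ih hJ
      obtain ⟨b, hb0, hbD, hb⟩ := ih hK
      rw [card_glue hJ, varProxy]
      rcases J.eq_empty_or_nonempty with rfl | hJn
      · have hKn : K.Nonempty := by simpa [glue_nonempty_iff hJ] using hne
        have hk : (1 : ℝ) ≤ K.card := by exact_mod_cast hKn.card_pos
        refine ⟨(2 / B) ^ n, b, hp, hb0, ?_, hempty, hb⟩
        rw [max_eq_left hk] at hbD
        rw [Finset.card_empty, zero_add, max_eq_left hk]
        nlinarith [sq_nonneg ((2 / B) ^ n - b), sq_nonneg ((2 / B) ^ n)]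
      · have hj : (1 : ℝ) ≤ J.card := by exact_mod_cast hJn.card_pos
        rw [max_eq_left hj] at haD
        rcases K.eq_empty_or_nonempty with rfl | hKn
        · refine ⟨a, (2 / B) ^ n, ha0, hp, ?_, ha, hempty⟩
          rw [Finset.card_empty, add_zero, max_eq_left hj]
          nlinarith [sq_nonneg ((2 / B) ^ n - a), sq_nonneg ((2 / B) ^ n)]
        · have hk : (1 : ℝ) ≤ K.card := by exact_mod_cast hKn.card_pos
          rw [max_eq_left hk] at hbD
          refine ⟨a, b, ha0, hb0, ?_, ha, hb⟩
          push_cast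
          rw [max_eq_left (by linarith)]
          have : 0 ≤ ((J.card : ℝ) + K.card) * (4 * ((2 / B) ^ n) ^ 2) := by positivity
          nlinarith [sq_nonneg (a - b)]
    refine ⟨a + b, by linarith, hab, fun s => ?_⟩
    rw [gwE_succ_deltaProd_mul B hJ hne, gwE_succ_deltaProd B hJ hne]
    have h1 : ∀ x y : GWTree n, deltaProd x J * deltaProd y K
        * Real.exp (s * numLeaves (GWTree.node x y))
        = (deltaProd x J * Real.exp (s * numLeaves x))
          * (deltaProd y K * Real.exp (s * numLeaves y)) := fun x y => by
      rw [numLeaves_node, mul_add, Real.exp_add]; ring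
    simp only [h1]
    rw [gwE_mul_gwE, mul_assoc]
    have hB0 : 0 < B := by linarith
    refine mul_le_mul_of_nonneg_left ?_ (by positivity)
    refine (mul_le_mul (ha s) (hb s)
      (gwE_nonneg hB fun t => mul_nonneg (deltaProd_nonneg _ _) (Real.exp_pos _).le)
      (mul_nonneg (gwE_deltaProd_nonneg hB J) (Real.exp_pos _).le)).trans ?_
    rw [mul_mul_mul_comm, ← Real.exp_add]
    refine mul_le_mul_of_nonneg_left (Real.exp_le_exp.2 ?_)
      (mul_nonneg (gwE_deltaProd_nonneg hB J) (gwE_deltaProd_nonneg hB K))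
    rw [varProxy]
    nlinarith [mul_nonneg (sq_nonneg ((2 / B) ^ n)) (sq_nonneg s)]

lemma gwE_deltaProd_mul_exp_sq_le {B : ℝ} (hB : 1 ≤ B) {n : ℕ} {I : Finset ℕ}
    (hI : I ⊆ Finset.range (2 ^ n)) {t : ℝ} (ht : 0 ≤ t) (htD : t * varProxy B n ≤ 1 / 8) :
    gwE B n (fun x => deltaProd x I * Real.exp (t * numLeaves x ^ 2))
      ≤ gwE B n (fun x => deltaProd x I)
        * Real.exp (6 * (t * varProxy B n) * max (I.card : ℝ) 1) := by
  obtain ⟨A, -, hA, h⟩ := exists_gwE_deltaProd_mul_exp_le hB n hI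
  have hD := varProxy_pos (B := B) n
  have h1 := sum_mul_exp_sq_le (fun x => gwProb B n x * deltaProd x I) numLeaves
    (gwE_deltaProd_nonneg hB I) hD.le (fun s => by simpa [gwE, mul_assoc] using h s) ht htD
  have h2 : gwE B n (fun x => deltaProd x I * Real.exp (t * numLeaves x ^ 2))
      = ∑ x, gwProb B n x * deltaProd x I * Real.exp (t * numLeaves x ^ 2) := by
    simp [gwE, mul_assoc]
  rw [h2]
  refine h1.trans (mul_le_mul_of_nonneg_left (Real.exp_le_exp.2 ?_) (gwE_deltaProd_nonneg hB I))
  have h3 : 1 ≤ max (I.card : ℝ) 1 := le_max_right _ _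
  have h4 := mul_le_mul_of_nonneg_left hA ht
  have h5 : 0 ≤ t * varProxy B n := by positivity
  nlinarith

/-- Two independent copies, interacting through the product of their numbers of leaves. -/
lemma gwE_gwE_deltaProd_mul_exp_le {B : ℝ} (hB : 1 ≤ B) {n : ℕ} {I J : Finset ℕ}
    (hI : I ⊆ Finset.range (2 ^ n)) (hJ : J ⊆ Finset.range (2 ^ n))
    (hne : I.Nonempty ∨ J.Nonempty) {t : ℝ} (ht : 0 ≤ t) (htD : t * varProxy B n ≤ 1 / 8) :
    gwE B n (fun x => gwE B n (fun y =>
        deltaProd x I * deltaProd y J * Real.exp (t * (numLeaves x * numLeaves y))))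
      ≤ gwE B n (fun x => deltaProd x I) * gwE B n (fun y => deltaProd y J)
        * Real.exp (6 * (t * varProxy B n) * (I.card + J.card)) := by
  have hD := varProxy_pos (B := B) n
  have ht2 : 0 ≤ t / 2 := by linarith
  have htD2 : t / 2 * varProxy B n ≤ 1 / 8 := by nlinarith
  calc _ ≤ gwE B n (fun x => gwE B n (fun y =>
        (deltaProd x I * Real.exp (t / 2 * numLeaves x ^ 2))
          * (deltaProd y J * Real.exp (t / 2 * numLeaves y ^ 2)))) := by
        refine gwE_mono hB fun x => gwE_mono hB fun y => ?_
        rw [mul_mul_mul_comm, ← Real.exp_add]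
        refine mul_le_mul_of_nonneg_left (Real.exp_le_exp.2 ?_)
          (mul_nonneg (deltaProd_nonneg _ _) (deltaProd_nonneg _ _))
        nlinarith [mul_nonneg ht (sq_nonneg (numLeaves x - numLeaves y))]
    _ = gwE B n (fun x => deltaProd x I * Real.exp (t / 2 * numLeaves x ^ 2))
        * gwE B n (fun y => deltaProd y J * Real.exp (t / 2 * numLeaves y ^ 2)) :=
        gwE_mul_gwE _ _ _ _
    _ ≤ (gwE B n (fun x => deltaProd x I)
          * Real.exp (6 * (t / 2 * varProxy B n) * max (I.card : ℝ) 1))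
        * (gwE B n (fun y => deltaProd y J)
          * Real.exp (6 * (t / 2 * varProxy B n) * max (J.card : ℝ) 1)) :=
        mul_le_mul (gwE_deltaProd_mul_exp_sq_le hB hI ht2 htD2)
          (gwE_deltaProd_mul_exp_sq_le hB hJ ht2 htD2)
          (gwE_nonneg hB fun t => mul_nonneg (deltaProd_nonneg _ _) (Real.exp_pos _).le)
          (mul_nonneg (gwE_deltaProd_nonneg hB I) (Real.exp_pos _).le)
    _ ≤ _ := by
        rw [mul_mul_mul_comm, ← Real.exp_add]
        refine mul_le_mul_of_nonneg_left (Real.exp_le_exp.2 ?_)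
          (mul_nonneg (gwE_deltaProd_nonneg hB I) (gwE_deltaProd_nonneg hB J))
        have h1 : max (I.card : ℝ) 1 + max (J.card : ℝ) 1 ≤ 2 * (I.card + J.card) := by
          have hc : 1 ≤ I.card + J.card := by
            rcases hne with h | h <;> have := h.card_pos <;> omega
          have hc' : (1 : ℝ) ≤ I.card + J.card := by exact_mod_cast hc
          have h1 : max (I.card : ℝ) 1 ≤ I.card + J.card :=
            max_le (by linarith [Nat.cast_nonneg (α := ℝ) J.card]) hc'
          have h2 : max (J.card : ℝ) 1 ≤ I.card + J.card :=
            max_le (by linarith [Nat.cast_nonneg (α := ℝ) I.card]) hc'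
          linarith
        have h2 : 0 ≤ t * varProxy B n := by positivity
        nlinarith

/-! ### The annealed Hamiltonian -/

lemma add_two_pow_div {n p : ℕ} (h : p ≤ n) (i : ℕ) :
    (i + 2 ^ n) / 2 ^ p = i / 2 ^ p + 2 ^ (n - p) := by
  obtain ⟨k, rfl⟩ := Nat.exists_eq_add_of_le h
  rw [pow_add, Nat.add_mul_div_left _ _ (by positivity), Nat.add_sub_cancel_left]

lemma hierDist_comm (i j : ℕ) : hierDist i j = hierDist j i := by
  simp only [hierDist, eq_comm]

lemma hierDist_self (i : ℕ) : hierDist i i = 0 := by simp [hierDist]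

lemma hierDist_add_add {n i j : ℕ} (hi : i < 2 ^ n) (hj : j < 2 ^ n) :
    hierDist (i + 2 ^ n) (j + 2 ^ n) = hierDist i j := by
  unfold hierDist
  congr 1
  ext p
  simp only [Set.mem_ofPred_eq]
  rcases le_or_gt p n with h | h
  · rw [add_two_pow_div h, add_two_pow_div h]; omega
  · have h1 : 2 ^ (n + 1) ≤ 2 ^ p := Nat.pow_le_pow_right (by norm_num) h
    rw [pow_succ] at h1
    rw [Nat.div_eq_of_lt (by omega), Nat.div_eq_of_lt (by omega), Nat.div_eq_of_lt (by omega),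
      Nat.div_eq_of_lt (by omega)]

lemma hierDist_add {n i j : ℕ} (hi : i < 2 ^ n) (hj : j < 2 ^ n) :
    hierDist i (j + 2 ^ n) = n + 1 := by
  have hmem : n + 1 ∈ {p : ℕ | i / 2 ^ p = (j + 2 ^ n) / 2 ^ p} := by
    simp only [Set.mem_ofPred_eq]
    rw [Nat.div_eq_of_lt (by rw [pow_succ]; omega), Nat.div_eq_of_lt (by rw [pow_succ]; omega)]
  refine le_antisymm (Nat.sInf_le hmem) (le_csInf ⟨_, hmem⟩ fun p hp => ?_)
  by_contra! hlt
  have hpn : p ≤ n := by omega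
  simp only [Set.mem_ofPred_eq] at hp
  rw [add_two_pow_div hpn] at hp
  have : i / 2 ^ p < 2 ^ (n - p) := by
    rw [Nat.div_lt_iff_lt_mul (by positivity), ← pow_add, Nat.sub_add_cancel hpn]
    exact hi
  generalize j / 2 ^ p = q at hp
  omega

/-- The sum of the correlations over all pairs of sites of a set. -/
noncomputable def pairSum (κ : ℝ) (I : Finset ℕ) : ℝ := ∑ i ∈ I, ∑ j ∈ I, κ ^ hierDist i j

lemma pairSum_glue (κ : ℝ) {n : ℕ} {I J : Finset ℕ} (hI : I ⊆ Finset.range (2 ^ n))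
    (hJ : J ⊆ Finset.range (2 ^ n)) :
    pairSum κ (glue n I J)
      = pairSum κ I + pairSum κ J + 2 * κ ^ (n + 1) * (I.card * J.card) := by
  have hI' : ∀ i ∈ I, i < 2 ^ n := fun i hi => Finset.mem_range.1 (hI hi)
  have hJ' : ∀ i ∈ J, i < 2 ^ n := fun i hi => Finset.mem_range.1 (hJ hi)
  simp only [pairSum, sum_glue hI, Finset.sum_add_distrib]
  have h1 : ∑ i ∈ I, ∑ j ∈ J, κ ^ hierDist i (j + 2 ^ n) = κ ^ (n + 1) * (I.card * J.card) := by
    rw [Finset.sum_congr rfl fun i hi => Finset.sum_congr rfl fun j hj => by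
      rw [hierDist_add (hI' i hi) (hJ' j hj)]]
    simp only [Finset.sum_const, nsmul_eq_mul]
    ring
  have h2 : ∑ j ∈ J, ∑ i ∈ I, κ ^ hierDist (j + 2 ^ n) i = κ ^ (n + 1) * (I.card * J.card) := by
    rw [← h1, Finset.sum_comm]
    simp only [hierDist_comm]
  have h3 : ∑ i ∈ J, ∑ j ∈ J, κ ^ hierDist (i + 2 ^ n) (j + 2 ^ n)
      = ∑ i ∈ J, ∑ j ∈ J, κ ^ hierDist i j :=
    Finset.sum_congr rfl fun i hi => Finset.sum_congr rfl fun j hj => by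
      rw [hierDist_add_add (hJ' i hi) (hJ' j hj)]
  rw [h1, h2, h3]
  ring

lemma annealedH_eq (κ β : ℝ) (n : ℕ) (h : ℝ) (t : GWTree n) :
    annealedH κ β n h t = h * numLeaves t + β ^ 2 / 2 * pairSum κ (leaves n t) := by
  rw [annealedH, ← numLeaves_eq_sum, pairSum]
  congr 2
  have h1 : ∀ i, ∑ j ∈ Finset.range (2 ^ n), κ ^ hierDist i j * delta t i * delta t j
      = (∑ j ∈ leaves n t, κ ^ hierDist i j) * delta t i := fun i => by
    rw [← sum_delta t, Finset.sum_mul]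
    exact Finset.sum_congr rfl fun _ _ => by ring
  simp only [h1]
  exact sum_delta t _

lemma annealedH_root (κ β h : ℝ) : annealedH κ β 0 h GWTree.root = h + β ^ 2 / 2 := by
  rw [annealedH_eq, numLeaves_zero]
  simp [leaves, pairSum, hierDist_self]

lemma annealedH_dead (κ β : ℝ) (n : ℕ) (h : ℝ) :
    annealedH κ β (n + 1) h (GWTree.dead n) = 0 := by
  simp [annealedH_eq, numLeaves_dead, leaves_dead, pairSum]

lemma annealedH_node (κ β : ℝ) {n : ℕ} (h : ℝ) (s t : GWTree n) :
    annealedH κ β (n + 1) h (GWTree.node s t) = annealedH κ β n h s + annealedH κ β n h t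
      + β ^ 2 * κ ^ (n + 1) * (numLeaves s * numLeaves t) := by
  simp only [annealedH_eq, numLeaves_node, leaves_node,
    pairSum_glue κ (leaves_subset n s) (leaves_subset n t)]
  simp only [numLeaves]
  ring

/-! ### Gibbs weights -/

/-- The partition function restricted to the trees in which all the sites of `I` are present. -/
noncomputable def gibbsW (B κ β h : ℝ) (n : ℕ) (I : Finset ℕ) : ℝ :=
  gwE B n (fun t => deltaProd t I * Real.exp (annealedH κ β n h t))

/-- The partition function of the annealed Hamiltonian. -/
noncomputable def gibbsZ (B κ β h : ℝ) (n : ℕ) : ℝ :=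
  gwE B n (fun t => Real.exp (annealedH κ β n h t))

lemma gibbsW_empty (B κ β h : ℝ) (n : ℕ) : gibbsW B κ β h n ∅ = gibbsZ B κ β h n := by
  simp [gibbsW, gibbsZ, deltaProd_empty]

lemma gibbsW_nonneg {B : ℝ} (hB : 1 ≤ B) (κ β h : ℝ) (n : ℕ) (I : Finset ℕ) :
    0 ≤ gibbsW B κ β h n I :=
  gwE_nonneg hB fun _ => mul_nonneg (deltaProd_nonneg _ _) (Real.exp_pos _).le

lemma gibbsZ_nonneg {B : ℝ} (hB : 1 ≤ B) (κ β h : ℝ) (n : ℕ) : 0 ≤ gibbsZ B κ β h n :=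
  gwE_nonneg hB fun _ => (Real.exp_pos _).le

/-- The weight of a pair of trees, both containing prescribed sites, with the interaction. -/
noncomputable def pairW (B κ β h : ℝ) (n : ℕ) (I J : Finset ℕ) : ℝ :=
  gwE B n (fun s => gwE B n (fun t =>
    deltaProd s I * deltaProd t J * Real.exp (annealedH κ β (n + 1) h (GWTree.node s t))))

lemma gibbsW_glue (B κ β h : ℝ) {n : ℕ} {I J : Finset ℕ} (hI : I ⊆ Finset.range (2 ^ n))
    (hne : (glue n I J).Nonempty) :
    gibbsW B κ β h (n + 1) (glue n I J) = 1 / B * pairW B κ β h n I J := by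
  rw [gibbsW, gwE_succ_deltaProd_mul B hI hne, pairW]

lemma gibbsZ_zero (B κ β h : ℝ) : gibbsZ B κ β h 0 = Real.exp (h + β ^ 2 / 2) := by
  rw [gibbsZ, gwE_zero, annealedH_root]

lemma gibbsZ_succ (B κ β h : ℝ) (n : ℕ) :
    gibbsZ B κ β h (n + 1) = (B - 1) / B + 1 / B * pairW B κ β h n ∅ ∅ := by
  rw [gibbsZ, gwE_succ, annealedH_dead, Real.exp_zero, mul_one, pairW]
  simp only [deltaProd_empty, one_mul]

lemma mul_le_pairW {B κ : ℝ} (hB : 1 ≤ B) (hκ : 0 ≤ κ) (β h : ℝ) (n : ℕ) (I J : Finset ℕ) :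
    gibbsW B κ β h n I * gibbsW B κ β h n J ≤ pairW B κ β h n I J := by
  rw [gibbsW, gibbsW, ← gwE_mul_gwE, pairW]
  refine gwE_mono hB fun s => gwE_mono hB fun t => ?_
  rw [mul_mul_mul_comm, ← Real.exp_add, annealedH_node]
  refine mul_le_mul_of_nonneg_left (Real.exp_le_exp.2 ?_)
    (mul_nonneg (deltaProd_nonneg _ _) (deltaProd_nonneg _ _))
  have := mul_nonneg (numLeaves_nonneg s) (numLeaves_nonneg t)
  have : 0 ≤ β ^ 2 * κ ^ (n + 1) * (numLeaves s * numLeaves t) := by positivity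
  linarith

lemma sq_add_le_gibbsZ_succ {B κ : ℝ} (hB : 1 ≤ B) (hκ : 0 ≤ κ) (β h : ℝ) (n : ℕ) :
    (gibbsZ B κ β h n ^ 2 + (B - 1)) / B ≤ gibbsZ B κ β h (n + 1) := by
  have h1 := mul_le_pairW hB hκ β h n ∅ ∅
  rw [gibbsW_empty] at h1
  have hB0 : 0 < B := by linarith
  rw [gibbsZ_succ, ← mul_div_right_comm, one_mul, ← add_div, sq, add_comm]
  gcongr

/-! ### Comparison of the Gibbs weights with the Galton-Watson law -/

lemma exp_numLeaves_eq_sum {n : ℕ} (s : ℝ) (t : GWTree n) :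
    Real.exp (s * numLeaves t)
      = ∑ T ∈ (Finset.range (2 ^ n)).powerset, (Real.exp s - 1) ^ T.card * deltaProd t T := by
  have h1 : ∀ i, Real.exp (s * delta t i) = 1 + (Real.exp s - 1) * delta t i := fun i => by
    unfold delta; split_ifs <;> simp
  rw [numLeaves_eq_sum, Finset.mul_sum, Real.exp_sum]
  simp only [h1]
  rw [Finset.prod_one_add]
  refine Finset.sum_congr rfl fun T _ => ?_
  rw [Finset.prod_mul_distrib, Finset.prod_const, deltaProd]

lemma mul_exp_sub_one_le {A s : ℝ} (hA : 1 ≤ A) :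
    A * (Real.exp s - 1) ≤ Real.exp (A * s) - 1 := by
  have := one_add_mul_self_le_rpow_one_add
    (by linarith [Real.exp_pos s] : -1 ≤ Real.exp s - 1) hA
  rw [add_sub_cancel, ← Real.exp_mul, mul_comm s] at this
  linarith

lemma gwE_deltaProd_mul_exp_le_of_le {B : ℝ} (hB : 1 ≤ B) {n : ℕ} {w : GWTree n → ℝ} {A : ℝ}
    (hA : 1 ≤ A)
    (hw : ∀ I ⊆ Finset.range (2 ^ n),
      gwE B n (fun t => deltaProd t I * w t) ≤ A ^ I.card * gwE B n (fun t => deltaProd t I))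
    {I : Finset ℕ} (hI : I ⊆ Finset.range (2 ^ n)) {s : ℝ} (hs : 0 ≤ s) :
    gwE B n (fun t => deltaProd t I * w t * Real.exp (s * numLeaves t))
      ≤ A ^ I.card * gwE B n (fun t => deltaProd t I * Real.exp (A * s * numLeaves t)) := by
  have hc : 0 ≤ Real.exp s - 1 := by linarith [Real.add_one_le_exp s]
  have h1 : ∀ (v : GWTree n → ℝ) (r : ℝ),
      gwE B n (fun t => deltaProd t I * v t * Real.exp (r * numLeaves t))
        = ∑ T ∈ (Finset.range (2 ^ n)).powerset,
          (Real.exp r - 1) ^ T.card * gwE B n (fun t => deltaProd t (I ∪ T) * v t) := by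
    intro v r
    simp only [exp_numLeaves_eq_sum, Finset.mul_sum, ← gwE_const_mul]
    rw [gwE_sum]
    refine Finset.sum_congr rfl fun T _ => ?_
    congr 1
    ext t
    rw [← deltaProd_mul]
    ring
  have h2 := h1 (fun _ => 1) (A * s)
  simp only [mul_one] at h2
  rw [h1 w s, h2, Finset.mul_sum]
  refine Finset.sum_le_sum fun T hT => ?_
  have hIT : I ∪ T ⊆ Finset.range (2 ^ n) := Finset.union_subset hI (Finset.mem_powerset.1 hT)
  have hE := gwE_deltaProd_nonneg hB (n := n) (I ∪ T)
  calc (Real.exp s - 1) ^ T.card * gwE B n (fun t => deltaProd t (I ∪ T) * w t)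
      ≤ (Real.exp s - 1) ^ T.card
          * (A ^ (I ∪ T).card * gwE B n (fun t => deltaProd t (I ∪ T))) := by
        gcongr; exact hw _ hIT
    _ ≤ (Real.exp s - 1) ^ T.card
          * (A ^ (I.card + T.card) * gwE B n (fun t => deltaProd t (I ∪ T))) := by
        gcongr
        exact Finset.card_union_le _ _
    _ = A ^ I.card * ((A * (Real.exp s - 1)) ^ T.card
          * gwE B n (fun t => deltaProd t (I ∪ T))) := by
        rw [pow_add, mul_pow]; ring
    _ ≤ _ := by
        gcongr
        exact mul_exp_sub_one_le hA

/-- The Gibbs weight of any set of prescribed sites is comparable with its Galton-Watson weight. -/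
def GibbsBound (B κ β h : ℝ) (n : ℕ) (A : ℝ) : Prop :=
  ∀ I ⊆ Finset.range (2 ^ n), gibbsW B κ β h n I ≤ A ^ I.card * gwE B n (fun t => deltaProd t I)

lemma pairW_le_gwE {B κ β h A : ℝ} (hB : 1 ≤ B) (hκ : 0 ≤ κ) {n : ℕ} (hA : 1 ≤ A)
    (hb : GibbsBound B κ β h n A) {I J : Finset ℕ} (hI : I ⊆ Finset.range (2 ^ n))
    (hJ : J ⊆ Finset.range (2 ^ n)) :
    pairW B κ β h n I J ≤ A ^ (I.card + J.card) * gwE B n (fun x => gwE B n (fun y =>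
      deltaProd x I * deltaProd y J
        * Real.exp (β ^ 2 * κ ^ (n + 1) * A ^ 2 * (numLeaves x * numLeaves y)))) := by
  set ε := β ^ 2 * κ ^ (n + 1) with hε
  have hε0 : 0 ≤ ε := by positivity
  have hA0 : 0 ≤ A := by linarith
  set w : GWTree n → ℝ := fun t => Real.exp (annealedH κ β n h t) with hw
  have hw0 : ∀ t, 0 ≤ w t := fun t => (Real.exp_pos _).le
  calc pairW B κ β h n I J
      = gwE B n (fun s => deltaProd s I * w s *
          gwE B n (fun t => deltaProd t J * w t * Real.exp (ε * numLeaves s * numLeaves t))) := by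
        rw [pairW]
        simp only [← gwE_const_mul]
        congr 1; ext s; congr 1; ext t
        rw [annealedH_node, Real.exp_add, Real.exp_add, mul_assoc ε]
        ring
    _ ≤ gwE B n (fun s => deltaProd s I * w s *
          (A ^ J.card * gwE B n (fun t => deltaProd t J
            * Real.exp (A * (ε * numLeaves s) * numLeaves t)))) := by
        refine gwE_mono hB fun s => mul_le_mul_of_nonneg_left ?_
          (mul_nonneg (deltaProd_nonneg _ _) (hw0 s))
        exact gwE_deltaProd_mul_exp_le_of_le hB hA hb hJ (mul_nonneg hε0 (numLeaves_nonneg s))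
    _ = A ^ J.card * gwE B n (fun t => deltaProd t J * gwE B n (fun s =>
          deltaProd s I * w s * Real.exp (A * ε * numLeaves t * numLeaves s))) := by
        simp only [← gwE_const_mul]
        rw [gwE_comm]
        congr 1; ext s; congr 1; ext t
        ring_nf
    _ ≤ A ^ J.card * gwE B n (fun t => deltaProd t J * (A ^ I.card * gwE B n (fun s =>
          deltaProd s I * Real.exp (A * (A * ε * numLeaves t) * numLeaves s)))) := by
        refine mul_le_mul_of_nonneg_left ?_ (by positivity)
        refine gwE_mono hB fun t => mul_le_mul_of_nonneg_left ?_ (deltaProd_nonneg _ _)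
        exact gwE_deltaProd_mul_exp_le_of_le hB hA hb hI
          (mul_nonneg (mul_nonneg hA0 hε0) (numLeaves_nonneg t))
    _ = _ := by
        simp only [← gwE_const_mul]
        rw [gwE_comm]
        congr 1; ext s; congr 1; ext t
        rw [pow_add]
        ring_nf

lemma pairW_le {B κ β h A : ℝ} (hB : 1 ≤ B) (hκ : 0 ≤ κ) {n : ℕ} (hA : 1 ≤ A)
    (hb : GibbsBound B κ β h n A) {I J : Finset ℕ} (hI : I ⊆ Finset.range (2 ^ n))
    (hJ : J ⊆ Finset.range (2 ^ n)) (hne : I.Nonempty ∨ J.Nonempty)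
    (hD : β ^ 2 * κ ^ (n + 1) * A ^ 2 * varProxy B n ≤ 1 / 8) :
    pairW B κ β h n I J
      ≤ (A * Real.exp (6 * (β ^ 2 * κ ^ (n + 1) * A ^ 2 * varProxy B n))) ^ (I.card + J.card)
        * (gwE B n (fun x => deltaProd x I) * gwE B n (fun y => deltaProd y J)) := by
  have hA0 : 0 ≤ A := by linarith
  refine (pairW_le_gwE hB hκ hA hb hI hJ).trans ?_
  refine (mul_le_mul_of_nonneg_left (gwE_gwE_deltaProd_mul_exp_le hB hI hJ hne (by positivity) hD)
    (by positivity)).trans (le_of_eq ?_)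
  rw [mul_pow, ← Real.exp_nat_mul, mul_comm (((I.card + J.card : ℕ)) : ℝ)]
  push_cast
  ring

lemma GibbsBound.succ {B κ β h A : ℝ} (hB : 1 ≤ B) (hκ : 0 ≤ κ) {n : ℕ} (hA : 1 ≤ A)
    (hb : GibbsBound B κ β h n A) (hZ : gibbsZ B κ β h (n + 1) ≤ 1)
    (hD : β ^ 2 * κ ^ (n + 1) * A ^ 2 * varProxy B n ≤ 1 / 8) :
    GibbsBound B κ β h (n + 1)
      (A * Real.exp (6 * (β ^ 2 * κ ^ (n + 1) * A ^ 2 * varProxy B n))) := by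
  intro K hK
  obtain ⟨I, hI, J, hJ, rfl⟩ := exists_eq_glue hK
  rcases (glue n I J).eq_empty_or_nonempty with he | hne
  · rw [he, gibbsW_empty]
    simpa [deltaProd_empty, gwE_const hB] using hZ
  · rw [gibbsW_glue B κ β h hI hne, gwE_succ_deltaProd B hI hne, card_glue hI]
    have hB0 : 0 < B := by linarith
    refine (mul_le_mul_of_nonneg_left (pairW_le hB hκ hA hb hI hJ ((glue_nonempty_iff hI).1 hne) hD)
      (by positivity)).trans (le_of_eq ?_)
    ring

lemma gibbsZ_succ_le {B κ β h A : ℝ} (hB : 1 ≤ B) (hκ : 0 ≤ κ) {n : ℕ} (hA : 1 ≤ A)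
    (hb : GibbsBound B κ β h n A)
    (hD : β ^ 2 * κ ^ (n + 1) * A ^ 2 * varProxy B n ≤ 1 / 8) :
    gibbsZ B κ β h (n + 1) ≤ (gibbsZ B κ β h n ^ 2 + (B - 1)) / B
      + β ^ 2 * κ ^ (n + 1)
        * (A * Real.exp (6 * (β ^ 2 * κ ^ (n + 1) * A ^ 2 * varProxy B n))) ^ 2
        * ((2 / B) ^ n) ^ 2 := by
  set C := A * Real.exp (6 * (β ^ 2 * κ ^ (n + 1) * A ^ 2 * varProxy B n)) with hC
  set ε := β ^ 2 * κ ^ (n + 1) with hε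
  have hε0 : 0 ≤ ε := by positivity
  have hB0 : 0 < B := by linarith
  have hC0 : 0 ≤ C := by positivity
  have key : pairW B κ β h n ∅ ∅ ≤ gibbsZ B κ β h n ^ 2
      + ε * ∑ i ∈ Finset.range (2 ^ n), ∑ j ∈ Finset.range (2 ^ n), pairW B κ β h n {i} {j} := by
    rw [sq, gibbsZ, ← gwE_mul_gwE]
    simp only [pairW, ← gwE_sum, ← gwE_const_mul, ← gwE_add]
    refine gwE_mono hB fun s => gwE_mono hB fun t => ?_
    simp only [deltaProd_empty, deltaProd_singleton, one_mul]
    rw [← Real.exp_add]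
    simp only [← Finset.sum_mul, ← Finset.mul_sum, ← numLeaves_eq_sum]
    rw [annealedH_node, ← hε]
    have h1 := Real.add_one_le_exp (-(ε * (numLeaves s * numLeaves t)))
    have h2 : Real.exp (annealedH κ β n h s + annealedH κ β n h t
        + ε * (numLeaves s * numLeaves t)) * Real.exp (-(ε * (numLeaves s * numLeaves t)))
        = Real.exp (annealedH κ β n h s + annealedH κ β n h t) := by
      rw [← Real.exp_add]; ring_nf
    have h3 := mul_le_mul_of_nonneg_left h1 (Real.exp_pos (annealedH κ β n h s
      + annealedH κ β n h t + ε * (numLeaves s * numLeaves t))).le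
    rw [h2] at h3
    linarith
  have hpair : ∀ i ∈ Finset.range (2 ^ n), ∀ j ∈ Finset.range (2 ^ n),
      pairW B κ β h n {i} {j}
        ≤ C ^ 2 * (gwE B n (fun x => delta x i) * gwE B n (fun y => delta y j)) := by
    intro i hi j hj
    have := pairW_le hB hκ hA hb (Finset.singleton_subset_iff.2 hi)
      (Finset.singleton_subset_iff.2 hj) (Or.inl (Finset.singleton_nonempty i)) hD
    simpa only [Finset.card_singleton, deltaProd_singleton, ← hC, ← hε, one_add_one_eq_two]
      using this
  have hsum : ∑ i ∈ Finset.range (2 ^ n), ∑ j ∈ Finset.range (2 ^ n), pairW B κ β h n {i} {j}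
      ≤ C ^ 2 * ((2 / B) ^ n) ^ 2 := by
    refine (Finset.sum_le_sum fun i hi => Finset.sum_le_sum fun j hj => hpair i hi j hj).trans
      (le_of_eq ?_)
    simp only [← Finset.mul_sum, ← Finset.sum_mul]
    rw [← gwE_numLeaves hB, ← gwE_sum]
    simp only [← numLeaves_eq_sum]
    ring
  rw [gibbsZ_succ]
  have h4 : 1 / B * pairW B κ β h n ∅ ∅
      ≤ 1 / B * gibbsZ B κ β h n ^ 2 + ε * C ^ 2 * ((2 / B) ^ n) ^ 2 := by
    have h5 : pairW B κ β h n ∅ ∅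
        ≤ gibbsZ B κ β h n ^ 2 + ε * C ^ 2 * ((2 / B) ^ n) ^ 2 := by
      have := mul_le_mul_of_nonneg_left hsum hε0
      linarith
    have h6 := mul_le_mul_of_nonneg_left h5 (by positivity : 0 ≤ 1 / B)
    have h7 : 1 / B * (ε * C ^ 2 * ((2 / B) ^ n) ^ 2) ≤ 1 * (ε * C ^ 2 * ((2 / B) ^ n) ^ 2) :=
      mul_le_mul_of_nonneg_right ((div_le_one hB0).2 hB) (by positivity)
    linarith
  have h8 : (gibbsZ B κ β h n ^ 2 + (B - 1)) / B
      = 1 / B * gibbsZ B κ β h n ^ 2 + (B - 1) / B := by ring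
  linarith

/-! ### Bounds at criticality -/

/-- The accumulated size of the interactions up to level `n`. -/
noncomputable def proxySum (B κ : ℝ) (n : ℕ) : ℝ := ∑ k ∈ Finset.range n, κ ^ k * varProxy B k

lemma proxySum_nonneg {B κ : ℝ} (hκ : 0 ≤ κ) (n : ℕ) : 0 ≤ proxySum B κ n :=
  Finset.sum_nonneg fun k _ => mul_nonneg (pow_nonneg hκ k) (varProxy_pos k).le

lemma pow_mul_mean_sq (B κ : ℝ) (n : ℕ) :
    κ ^ n * ((2 / B) ^ n) ^ 2 = (4 * κ / B ^ 2) ^ n := by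
  rw [← pow_mul, mul_comm n 2, pow_mul, ← mul_pow]
  congr 1
  rw [div_pow]
  ring

lemma exists_proxySum_le {B κ : ℝ} (hB : 1 ≤ B) (hκ0 : 0 ≤ κ) (hκ : κ < 1 / 2)
    (hθ : 4 * κ / B ^ 2 < 1) : ∃ C ≥ 1, ∀ n, proxySum B κ n ≤ C := by
  set θ := 4 * κ / B ^ 2 with hθd
  have hθ0 : 0 ≤ θ := by positivity
  have h1 : 0 < 1 - 2 * κ := by linarith
  have h2 : 0 < 1 - θ := by linarith
  set K := 1 / (1 - 2 * κ) with hK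
  set L := 4 * κ * K / (1 - θ) with hL
  have hK1 : 1 ≤ K := by rw [hK, le_div_iff₀ h1]; linarith
  have hL0 : 0 ≤ L := by positivity
  have hKe : K * (1 - 2 * κ) = 1 := by rw [hK]; field_simp
  have hLe : L * (1 - θ) = 4 * κ * K := by rw [hL]; field_simp
  have key : ∀ n, proxySum B κ n + K * (κ ^ n * varProxy B n) + L * θ ^ n ≤ K + L := by
    intro n
    induction n with
    | zero => simp [proxySum, varProxy]
    | succ n ih =>
      refine le_trans (le_of_eq ?_) ih
      have h3 := pow_mul_mean_sq B κ n
      rw [← hθd] at h3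
      rw [proxySum, Finset.sum_range_succ, ← proxySum, varProxy, pow_succ, pow_succ]
      linear_combination (4 * κ * K) * h3 - θ ^ n * hLe - κ ^ n * varProxy B n * hKe
  refine ⟨K + L, by linarith, fun n => ?_⟩
  have h3 := key n
  have h4 : 0 ≤ K * (κ ^ n * varProxy B n) :=
    mul_nonneg (by linarith) (mul_nonneg (pow_nonneg hκ0 n) (varProxy_pos n).le)
  have h5 : 0 ≤ L * θ ^ n := by positivity
  linarith

/-- An upper bound for the sum of the correlations between one site and all the other ones. -/
noncomputable def corrBound (κ : ℝ) : ℝ := 1 + κ / (1 - 2 * κ)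

lemma pairSum_leaves_le {κ : ℝ} (hκ0 : 0 ≤ κ) (hκ : κ < 1 / 2) {n : ℕ} (t : GWTree n) :
    pairSum κ (leaves n t) ≤ corrBound κ * numLeaves t := by
  have h1 : 0 < 1 - 2 * κ := by linarith
  set L := κ / (1 - 2 * κ) with hL
  have hLe : L * (1 - 2 * κ) = κ := div_mul_cancel₀ κ h1.ne'
  have hL0 : 0 ≤ L := by positivity
  suffices h : ∀ (n : ℕ) (t : GWTree n),
      pairSum κ (leaves n t) ≤ (1 + L - L * (2 * κ) ^ n) * numLeaves t by
    refine (h n t).trans (mul_le_mul_of_nonneg_right ?_ (numLeaves_nonneg t))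
    have : 0 ≤ L * (2 * κ) ^ n := by positivity
    rw [corrBound]
    linarith
  intro n
  induction n with
  | zero => intro t; simp [leaves, pairSum, hierDist_self, numLeaves_zero]
  | succ n ih =>
    intro t
    rcases t.cases_succ with rfl | ⟨s, s', rfl⟩
    · simp [leaves_dead, pairSum, numLeaves_dead]
    · rw [leaves_node, pairSum_glue κ (leaves_subset n s) (leaves_subset n s'), numLeaves_node]
      have h2 := ih s
      have h3 := ih s'
      have h4 : 2 * (numLeaves s * numLeaves s') ≤ 2 ^ n * (numLeaves s + numLeaves s') := by
        nlinarith [numLeaves_le s, numLeaves_le s', numLeaves_nonneg s, numLeaves_nonneg s']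
      have h5 : 0 ≤ κ ^ (n + 1) := by positivity
      have h6 := mul_le_mul_of_nonneg_left h4 h5
      have h7 : κ ^ (n + 1) * 2 ^ n = L * (2 * κ) ^ n - L * (2 * κ) ^ (n + 1) := by
        rw [mul_pow, pow_succ (2 * κ), mul_pow, pow_succ]
        linear_combination (-(2 ^ n * κ ^ n)) * hLe
      rw [← mul_assoc _ (2 ^ n), h7] at h6
      simp only [numLeaves] at *
      linarith

lemma gibbsBound_zero {B κ β h : ℝ} (hZ : gibbsZ B κ β h 0 ≤ 1) :
    GibbsBound B κ β h 0 1 := by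
  intro I _
  rw [gibbsZ, gwE_zero] at hZ
  rw [gibbsW, gwE_zero, gwE_zero, one_pow, one_mul]
  exact mul_le_of_le_one_right (deltaProd_nonneg _ _) hZ

lemma exp_proxySum_sq_le {B κ β C : ℝ} (hC : ∀ n, proxySum B κ n ≤ C)
    (hβ : β ^ 2 * C ≤ 1 / 48) (n : ℕ) : Real.exp (24 * β ^ 2 * proxySum B κ n) ^ 2 ≤ 4 := by
  have h1 : Real.exp (24 * β ^ 2 * proxySum B κ n) ^ 2 ≤ Real.exp 1 := by
    rw [← Real.exp_nat_mul]
    apply Real.exp_le_exp.2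
    have := mul_le_mul_of_nonneg_left (hC n) (sq_nonneg β)
    push_cast
    linarith
  linarith [Real.exp_one_lt_three]

lemma interaction_le {B κ β C : ℝ} (hκ0 : 0 ≤ κ) (hκ : κ ≤ 1)
    (hC : ∀ n, proxySum B κ n ≤ C) (hβ : β ^ 2 * C ≤ 1 / 48) (n : ℕ) :
    β ^ 2 * κ ^ (n + 1) * Real.exp (24 * β ^ 2 * proxySum B κ n) ^ 2 * varProxy B n
      ≤ 4 * β ^ 2 * (κ ^ n * varProxy B n) := by
  have h1 := exp_proxySum_sq_le hC hβ n
  have hD := varProxy_pos (B := B) n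
  have h2 : κ ^ (n + 1) ≤ κ ^ n := pow_le_pow_of_le_one hκ0 hκ (Nat.le_succ n)
  calc _ ≤ β ^ 2 * κ ^ n * 4 * varProxy B n := by gcongr
    _ = _ := by ring

lemma interaction_le_eighth {B κ β C : ℝ} (hκ0 : 0 ≤ κ) (hκ : κ ≤ 1)
    (hC : ∀ n, proxySum B κ n ≤ C) (hβ : β ^ 2 * C ≤ 1 / 48) (n : ℕ) :
    β ^ 2 * κ ^ (n + 1) * Real.exp (24 * β ^ 2 * proxySum B κ n) ^ 2 * varProxy B n ≤ 1 / 8 := by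
  refine (interaction_le hκ0 hκ hC hβ n).trans ?_
  have h1 := hC (n + 1)
  rw [proxySum, Finset.sum_range_succ, ← proxySum] at h1
  have h2 := proxySum_nonneg (B := B) hκ0 n
  have := mul_le_mul_of_nonneg_left (by linarith : κ ^ n * varProxy B n ≤ C) (sq_nonneg β)
  linarith

lemma exp_proxySum_mul_exp_le {B κ β C : ℝ} (hκ0 : 0 ≤ κ) (hκ : κ ≤ 1)
    (hC : ∀ n, proxySum B κ n ≤ C) (hβ : β ^ 2 * C ≤ 1 / 48) (n : ℕ) :
    Real.exp (24 * β ^ 2 * proxySum B κ n) * Real.exp (6 * (β ^ 2 * κ ^ (n + 1)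
        * Real.exp (24 * β ^ 2 * proxySum B κ n) ^ 2 * varProxy B n))
      ≤ Real.exp (24 * β ^ 2 * proxySum B κ (n + 1)) := by
  rw [← Real.exp_add]
  apply Real.exp_le_exp.2
  have := interaction_le hκ0 hκ hC hβ n
  rw [proxySum, proxySum, Finset.sum_range_succ, ← proxySum]
  linarith

lemma one_le_exp_proxySum {B κ β : ℝ} (hκ0 : 0 ≤ κ) (n : ℕ) :
    1 ≤ Real.exp (24 * β ^ 2 * proxySum B κ n) :=
  Real.one_le_exp (mul_nonneg (by positivity) (proxySum_nonneg hκ0 n))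

lemma gibbsBound_of_gibbsZ_le_one {B κ β h C : ℝ} (hB : 1 ≤ B) (hκ0 : 0 ≤ κ) (hκ : κ ≤ 1)
    (hC : ∀ n, proxySum B κ n ≤ C) (hβ : β ^ 2 * C ≤ 1 / 48) (n : ℕ)
    (hZ : ∀ k ≤ n, gibbsZ B κ β h k ≤ 1) :
    GibbsBound B κ β h n (Real.exp (24 * β ^ 2 * proxySum B κ n)) := by
  induction n with
  | zero => simpa [proxySum] using gibbsBound_zero (hZ 0 le_rfl)
  | succ n ih =>
    intro I hI
    refine ((ih fun k hk => hZ k (by omega)).succ hB hκ0 (one_le_exp_proxySum hκ0 n)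
      (hZ _ le_rfl) (interaction_le_eighth hκ0 hκ hC hβ n) I hI).trans ?_
    refine mul_le_mul_of_nonneg_right ?_ (gwE_deltaProd_nonneg hB I)
    exact pow_le_pow_left₀ (by positivity) (exp_proxySum_mul_exp_le hκ0 hκ hC hβ n) _

lemma gibbsZ_succ_le_of_gibbsZ_le_one {B κ β h C : ℝ} (hB : 1 ≤ B) (hκ0 : 0 ≤ κ) (hκ : κ ≤ 1)
    (hC : ∀ n, proxySum B κ n ≤ C) (hβ : β ^ 2 * C ≤ 1 / 48) (n : ℕ)
    (hZ : ∀ k ≤ n, gibbsZ B κ β h k ≤ 1) :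
    gibbsZ B κ β h (n + 1)
      ≤ (gibbsZ B κ β h n ^ 2 + (B - 1)) / B + 4 * β ^ 2 * (4 * κ / B ^ 2) ^ n := by
  refine (gibbsZ_succ_le hB hκ0 (one_le_exp_proxySum hκ0 n)
    (gibbsBound_of_gibbsZ_le_one hB hκ0 hκ hC hβ n hZ)
    (interaction_le_eighth hκ0 hκ hC hβ n)).trans ?_
  refine add_le_add_right ?_ _
  have h1 : (Real.exp (24 * β ^ 2 * proxySum B κ n) * Real.exp (6 * (β ^ 2 * κ ^ (n + 1)
        * Real.exp (24 * β ^ 2 * proxySum B κ n) ^ 2 * varProxy B n))) ^ 2 ≤ 4 :=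
    (pow_le_pow_left₀ (by positivity) (exp_proxySum_mul_exp_le hκ0 hκ hC hβ n) 2).trans
      (exp_proxySum_sq_le hC hβ (n + 1))
  have h2 : κ ^ (n + 1) ≤ κ ^ n := pow_le_pow_of_le_one hκ0 hκ (Nat.le_succ n)
  rw [← pow_mul_mean_sq]
  calc _ ≤ β ^ 2 * κ ^ n * 4 * ((2 / B) ^ n) ^ 2 := by gcongr
    _ = _ := by ring

lemma one_lt_gibbsZ_of_lt {B κ β h : ℝ} (hB : 1 ≤ B) (hκ : 0 ≤ κ) {n m : ℕ} (hnm : n ≤ m)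
    (hn : 1 < gibbsZ B κ β h n) : 1 < gibbsZ B κ β h m := by
  induction m, hnm using Nat.le_induction with
  | base => exact hn
  | succ m _ ih =>
    refine lt_of_lt_of_le ?_ (sq_add_le_gibbsZ_succ hB hκ β h m)
    rw [lt_div_iff₀ (by linarith)]
    nlinarith

lemma continuous_gibbsZ (B κ β : ℝ) (n : ℕ) : Continuous (fun h => gibbsZ B κ β h n) := by
  unfold gibbsZ gwE
  simp only [annealedH_eq]
  fun_prop

/-- The largest value of `h` for which the partition functions of all sizes are at most `1`. -/
structure IsCritical (B κ β h : ℝ) : Prop where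
  gibbsZ_le_one : ∀ n, gibbsZ B κ β h n ≤ 1
  exists_one_lt : ∀ h' > h, ∃ n, 1 < gibbsZ B κ β h' n

lemma gibbsZ_le_one_of_nonpos {B κ β h : ℝ} (hB : 1 ≤ B) (hκ0 : 0 ≤ κ) (hκ : κ < 1 / 2)
    (hh : h + β ^ 2 / 2 * corrBound κ ≤ 0) (n : ℕ) : gibbsZ B κ β h n ≤ 1 := by
  rw [← gwE_const hB 1 n]
  refine gwE_mono hB fun t => Real.exp_le_one_iff.2 ?_
  rw [annealedH_eq]
  have h1 := mul_le_mul_of_nonneg_left (pairSum_leaves_le hκ0 hκ t)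
    (by positivity : 0 ≤ β ^ 2 / 2)
  have h2 := mul_nonpos_of_nonpos_of_nonneg hh (numLeaves_nonneg t)
  linarith

lemma IsCritical.ge {B κ β h : ℝ} (hc : IsCritical B κ β h) (hB : 1 ≤ B) (hκ0 : 0 ≤ κ)
    (hκ : κ < 1 / 2) : -(β ^ 2 / 2 * corrBound κ) ≤ h := by
  by_contra! hlt
  obtain ⟨n, hn⟩ := hc.exists_one_lt _ hlt
  exact hn.not_ge (gibbsZ_le_one_of_nonpos hB hκ0 hκ (by linarith) n)

lemma IsCritical.one_sub_le_gibbsZ {B κ β h C : ℝ} (hc : IsCritical B κ β h) (hB : 1 ≤ B)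
    (hκ0 : 0 ≤ κ) (hκ : κ ≤ 1) (hθ : 4 * κ / B ^ 2 < 1)
    (hC : ∀ n, proxySum B κ n ≤ C) (hβ : β ^ 2 * C ≤ 1 / 48)
    (hβ' : 4 / (1 - 4 * κ / B ^ 2) * β ^ 2 ≤ 2 - B) (n : ℕ) :
    1 - 4 / (1 - 4 * κ / B ^ 2) * β ^ 2 * (4 * κ / B ^ 2) ^ n ≤ gibbsZ B κ β h n := by
  set θ := 4 * κ / B ^ 2 with hθd
  have hθ0 : 0 ≤ θ := by positivity
  have hθ1 : 0 < 1 - θ := by linarith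
  set c := 4 / (1 - θ) with hcd
  have hc0 : 0 < c := by positivity
  have hce : c * (1 - θ) = 4 := by rw [hcd]; field_simp
  by_contra! hlt
  have hev : ∀ᶠ h' in 𝓝[>] h, gibbsZ B κ β h' n < 1 - c * β ^ 2 * θ ^ n :=
    ((continuous_gibbsZ B κ β n).continuousWithinAt (s := Set.Ioi h)).eventually_lt_const hlt
  obtain ⟨h', hh', hgt⟩ := (hev.and self_mem_nhdsWithin).exists
  have hprop : ∀ m ≥ n, gibbsZ B κ β h' m ≤ 1 - c * β ^ 2 * θ ^ m := by
    intro m hm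
    induction m, hm using Nat.le_induction with
    | base => exact hh'.le
    | succ m _ ih =>
      have hy0 : 0 ≤ c * β ^ 2 * θ ^ m := by positivity
      have hyB : c * β ^ 2 * θ ^ m ≤ 2 - B :=
        (mul_le_of_le_one_right (by positivity) (pow_le_one₀ hθ0 hθ.le)).trans hβ'
      have hle : ∀ k ≤ m, gibbsZ B κ β h' k ≤ 1 := fun k hk => by
        by_contra! h1
        linarith [one_lt_gibbsZ_of_lt hB hκ0 hk h1]
      refine (gibbsZ_succ_le_of_gibbsZ_le_one hB hκ0 hκ hC hβ m hle).trans ?_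
      rw [← hθd]
      have hB0 : 0 < B := by linarith
      set y := c * β ^ 2 * θ ^ m with hy
      have h2 : 4 * β ^ 2 * θ ^ m = y * (1 - θ) := by rw [← hce, hy]; ring
      have h3 : c * β ^ 2 * θ ^ (m + 1) = y * θ := by rw [hy, pow_succ]; ring
      have h4 : gibbsZ B κ β h' m ^ 2 ≤ (1 - y) ^ 2 :=
        pow_le_pow_left₀ (gibbsZ_nonneg hB κ β h' m) ih 2
      rw [h2, h3, ← le_sub_iff_add_le, div_le_iff₀ hB0]
      nlinarith
  obtain ⟨k, hk⟩ := hc.exists_one_lt h' hgt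
  have h1 := one_lt_gibbsZ_of_lt hB hκ0 (le_max_right n k) hk
  have h2 := hprop _ (le_max_left n k)
  have : 0 ≤ c * β ^ 2 * θ ^ max n k := by positivity
  linarith

lemma exp_neg_two_mul_le {y : ℝ} (h0 : 0 ≤ y) (h1 : y ≤ 1 / 2) : Real.exp (-(2 * y)) ≤ 1 - y := by
  rw [Real.exp_neg]
  refine inv_le_of_inv_le₀ (by linarith) ?_
  rw [inv_le_iff_one_le_mul₀' (by linarith)]
  nlinarith [Real.add_one_le_exp (2 * y)]

/-- The lower bound on the restricted partition functions follows from the one on the full ones. -/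
lemma le_gibbsW_of_le_gibbsZ {B κ β h a c θ : ℝ} (hB : 1 ≤ B) (hκ : 0 ≤ κ) (hc : 0 ≤ c)
    (hθ : 0 ≤ θ) (h0 : Real.exp (-a) ≤ gibbsZ B κ β h 0)
    (hZ : ∀ n, Real.exp (-(c * θ ^ n)) ≤ gibbsZ B κ β h n) (n : ℕ) {I : Finset ℕ}
    (hI : I ⊆ Finset.range (2 ^ n)) (hne : I.Nonempty) :
    Real.exp (-(a + c * ∑ k ∈ Finset.range n, θ ^ k)) ^ I.card
        * gwE B n (fun t => deltaProd t I) ≤ gibbsW B κ β h n I := by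
  induction n generalizing I with
  | zero =>
    have hI0 : I = {0} := by
      rw [pow_zero, Finset.range_one] at hI
      exact (Finset.subset_singleton_iff.1 hI).resolve_left hne.ne_empty
    rw [gibbsZ, gwE_zero] at h0
    rw [gibbsW, gwE_zero, gwE_zero, hI0, Finset.card_singleton, pow_one, mul_comm]
    simp only [Finset.range_zero, Finset.sum_empty, mul_zero, add_zero]
    exact mul_le_mul_of_nonneg_left h0 (deltaProd_nonneg _ _)
  | succ n ih =>
    obtain ⟨J, hJ, K, hK, rfl⟩ := exists_eq_glue hI
    set b := Real.exp (-(a + c * ∑ k ∈ Finset.range n, θ ^ k)) with hb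
    set r := Real.exp (-(c * θ ^ n)) with hr
    have hb0 : 0 < b := Real.exp_pos _
    have hr0 : 0 < r := Real.exp_pos _
    have hr1 : r ≤ 1 := Real.exp_le_one_iff.2 (by
      have : 0 ≤ c * θ ^ n := by positivity
      linarith)
    have hbr : Real.exp (-(a + c * ∑ k ∈ Finset.range (n + 1), θ ^ k)) = b * r := by
      rw [hb, hr, ← Real.exp_add, Finset.sum_range_succ]; ring_nf
    have hEJ := gwE_deltaProd_nonneg hB (n := n) J
    have hEK := gwE_deltaProd_nonneg hB (n := n) K
    have hB0 : 0 < B := by linarith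
    have hmain : (b * r) ^ (J.card + K.card)
        * (gwE B n (fun t => deltaProd t J) * gwE B n (fun t => deltaProd t K))
        ≤ gibbsW B κ β h n J * gibbsW B κ β h n K := by
      have hstep : ∀ {L : Finset ℕ}, L ⊆ Finset.range (2 ^ n) → L.Nonempty →
          (b * r) ^ L.card * gwE B n (fun t => deltaProd t L) ≤ r * gibbsW B κ β h n L := by
        intro L hL hLne
        rw [mul_pow]
        have h1 : r ^ L.card ≤ r := by
          simpa using pow_le_pow_of_le_one hr0.le hr1 (Nat.one_le_iff_ne_zero.2 hLne.card_ne_zero)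
        calc b ^ L.card * r ^ L.card * gwE B n (fun t => deltaProd t L)
            ≤ b ^ L.card * r * gwE B n (fun t => deltaProd t L) := by
              have := gwE_deltaProd_nonneg hB (n := n) L
              gcongr
          _ = r * (b ^ L.card * gwE B n (fun t => deltaProd t L)) := by ring
          _ ≤ _ := mul_le_mul_of_nonneg_left (ih hL hLne) hr0.le
      have hEmpty : gwE B n (fun t => deltaProd t ∅) = 1 := by
        simp [deltaProd_empty, gwE_const hB]
      rcases J.eq_empty_or_nonempty with rfl | hJn
      · have hKn : K.Nonempty := by simpa [glue_nonempty_iff hJ] using hne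
        rw [Finset.card_empty, zero_add, hEmpty, one_mul, gibbsW_empty]
        exact (hstep hK hKn).trans
          (mul_le_mul_of_nonneg_right (hZ n) (gibbsW_nonneg hB _ _ _ _ _))
      · rcases K.eq_empty_or_nonempty with rfl | hKn
        · rw [Finset.card_empty, add_zero, hEmpty, mul_one, gibbsW_empty,
            mul_comm (gibbsW _ _ _ _ _ _)]
          exact (hstep hJ hJn).trans
            (mul_le_mul_of_nonneg_right (hZ n) (gibbsW_nonneg hB _ _ _ _ _))
        · have hle : ∀ {L : Finset ℕ}, L ⊆ Finset.range (2 ^ n) → L.Nonempty →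
              (b * r) ^ L.card * gwE B n (fun t => deltaProd t L) ≤ gibbsW B κ β h n L :=
            fun hL hLne => (hstep hL hLne).trans
              (mul_le_of_le_one_left (gibbsW_nonneg hB _ _ _ _ _) hr1)
          rw [pow_add, mul_mul_mul_comm]
          exact mul_le_mul (hle hJ hJn) (hle hK hKn) (by positivity) (gibbsW_nonneg hB _ _ _ _ _)
    rw [hbr, gibbsW_glue B κ β h hJ hne, gwE_succ_deltaProd B hJ hne, card_glue hJ]
    calc _ = 1 / B * ((b * r) ^ (J.card + K.card)
        * (gwE B n (fun t => deltaProd t J) * gwE B n (fun t => deltaProd t K))) := by ring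
      _ ≤ 1 / B * pairW B κ β h n J K :=
        mul_le_mul_of_nonneg_left (hmain.trans (mul_le_pairW hB hκ β h n J K)) (by positivity)

/-! ### The annealed partition function -/

lemma quenchedZ_eq_gwE {B : ℝ} (β h : ℝ) (w : ℕ → ℝ) (n i : ℕ) :
    quenchedZ B β h w n i
      = gwE B n (fun t => Real.exp (∑ j ∈ leaves n t, (β * w (i * 2 ^ n + j) + h))) := by
  induction n generalizing i with
  | zero => rw [gwE_zero]; simp [quenchedZ, leaves]
  | succ n ih =>
    rw [quenchedZ, ih, ih, gwE_succ, leaves_dead, Finset.sum_empty, Real.exp_zero, mul_one]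
    simp only [leaves_node, sum_glue (leaves_subset n _), Real.exp_add]
    rw [gwE_mul_gwE]
    have h1 : ∀ j, 2 * i * 2 ^ n + j = i * 2 ^ (n + 1) + j := fun j => by ring
    have h2 : ∀ j, (2 * i + 1) * 2 ^ n + j = i * 2 ^ (n + 1) + (j + 2 ^ n) := fun j => by ring
    simp only [h1, h2]
    ring

section Disorder

variable {Ω : Type*} [MeasurableSpace Ω] {P : Measure Ω} {ω : ℕ → Ω → ℝ}
  {κ : ℝ}

lemma IsHierDisorder.variance_sum (hω : IsHierDisorder κ P ω) (R : Finset ℕ) :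
    Var[fun x => ∑ i ∈ R, ω i x; P] = pairSum κ R := by
  have hL := hω.gaussian.hasGaussianLaw_fun_sum (I := R)
  have hm : ∀ i, MemLp (ω i) 2 P := fun i => (hω.gaussian.hasGaussianLaw_eval i).memLp_two
  have hint : ∀ i j, Integrable (fun x => ω i x * ω j x) P := fun i j =>
    (hm i).integrable_mul (hm j)
  rw [variance_of_integral_eq_zero hL.aemeasurable]
  · simp only [sq, Finset.sum_mul_sum]
    rw [integral_finsetSum _ fun i _ => integrable_finsetSum _ fun j _ => hint i j, pairSum]
    refine Finset.sum_congr rfl fun i _ => ?_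
    rw [integral_finsetSum _ fun j _ => hint i j]
    exact Finset.sum_congr rfl fun j _ => hω.correlation i j
  · rw [integral_finsetSum _ fun i _ => (hω.gaussian.hasGaussianLaw_eval i).integrable]
    simp [hω.centered]

lemma IsHierDisorder.mgf_sum (hω : IsHierDisorder κ P ω) (R : Finset ℕ) (β : ℝ) :
    mgf (fun x => ∑ i ∈ R, ω i x) P β = Real.exp (β ^ 2 / 2 * pairSum κ R) := by
  have hL := hω.gaussian.hasGaussianLaw_fun_sum (I := R)
  have hmean : ∫ x, ∑ i ∈ R, ω i x ∂P = 0 := by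
    rw [integral_finsetSum _ fun i _ => (hω.gaussian.hasGaussianLaw_eval i).integrable]
    simp [hω.centered]
  rw [mgf_gaussianReal hL.map_eq_gaussianReal, hmean, hω.variance_sum,
    Real.coe_toNNReal _ (by rw [← hω.variance_sum]; exact variance_nonneg _ _)]
  congr 1
  ring

lemma IsHierDisorder.annealedZ_eq (hω : IsHierDisorder κ P ω) (B β h : ℝ) (n : ℕ) :
    annealedZ P ω B β n h = gibbsZ B κ β h n := by
  have := hω.gaussian.isProbabilityMeasure
  have h1 : ∀ (t : GWTree n) (x : Ω), Real.exp (∑ j ∈ leaves n t, (β * ω (0 * 2 ^ n + j) x + h))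
      = Real.exp (h * numLeaves t) * Real.exp (β * ∑ j ∈ leaves n t, ω j x) := fun t x => by
    rw [← Real.exp_add, Finset.sum_add_distrib, Finset.mul_sum, Finset.sum_const, nsmul_eq_mul,
      numLeaves]
    simp only [zero_mul, zero_add]
    ring_nf
  have hint : ∀ t : GWTree n, Integrable (fun x => Real.exp (β * ∑ j ∈ leaves n t, ω j x)) P :=
    fun t => mgf_pos_iff.1 (by rw [hω.mgf_sum]; exact Real.exp_pos _)
  simp only [annealedZ, quenchedZ_eq_gwE, h1, gibbsZ, gwE]
  rw [integral_finsetSum _ fun t _ => ((hint t).const_mul _).const_mul _]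
  refine Finset.sum_congr rfl fun t _ => ?_
  rw [integral_const_mul, integral_const_mul]
  have h2 := hω.mgf_sum (leaves n t) β
  rw [mgf] at h2
  rw [h2, ← Real.exp_add, annealedH_eq]

end Disorder

/-! ### The free energy and the critical point -/

lemma gibbsZ_pos {B : ℝ} (hB : 1 < B) (κ β h : ℝ) {n : ℕ} : 0 < gibbsZ B κ β h n := by
  rw [gibbsZ]
  cases n with
  | zero => rw [gwE_zero]; exact Real.exp_pos _
  | succ n =>
    rw [gwE_succ, annealedH_dead, Real.exp_zero, mul_one]
    have : 0 < (B - 1) / B := div_pos (by linarith) (by linarith)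
    have h2 : 0 ≤ 1 / B * gwE B n (fun s => gwE B n (fun t =>
        Real.exp (annealedH κ β (n + 1) h (GWTree.node s t)))) :=
      mul_nonneg (div_nonneg zero_le_one (by linarith))
        (gwE_nonneg hB.le fun s => gwE_nonneg hB.le fun t => (Real.exp_pos _).le)
    linarith

lemma le_gibbsZ {B κ : ℝ} (hB : 1 < B) (hκ : 0 ≤ κ) (β h : ℝ) :
    ∃ c > 0, ∀ n, c ≤ gibbsZ B κ β h n := by
  refine ⟨min (gibbsZ B κ β h 0) ((B - 1) / B), lt_min (gibbsZ_pos hB κ β h)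
    (div_pos (by linarith) (by linarith)), fun n => ?_⟩
  cases n with
  | zero => exact min_le_left _ _
  | succ n =>
    refine (min_le_right _ _).trans (le_trans ?_ (sq_add_le_gibbsZ_succ hB.le hκ β h n))
    have : 0 < B := by linarith
    gcongr
    nlinarith [sq_nonneg (gibbsZ B κ β h n)]

lemma tendsto_one_div_two_pow : Tendsto (fun n : ℕ => (1 : ℝ) / 2 ^ n) atTop (𝓝 0) := by
  simpa [one_div] using tendsto_pow_atTop_nhds_zero_of_lt_one
    (by norm_num : (0 : ℝ) ≤ 1 / 2) (by norm_num)

lemma tendsto_freeEnergy_zero {B κ β h : ℝ} (hB : 1 < B) (hκ : 0 ≤ κ)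
    (hZ : ∀ n, gibbsZ B κ β h n ≤ 1) :
    Tendsto (fun n : ℕ => 1 / 2 ^ n * Real.log (gibbsZ B κ β h n)) atTop (𝓝 0) := by
  obtain ⟨c, hc0, hc⟩ := le_gibbsZ hB hκ β h
  have h1 := tendsto_one_div_two_pow.mul_const (Real.log c)
  rw [zero_mul] at h1
  refine tendsto_of_tendsto_of_tendsto_of_le_of_le h1 tendsto_const_nhds (fun n => ?_) fun n => ?_
  · exact mul_le_mul_of_nonneg_left (Real.log_le_log hc0 (hc n)) (by positivity)
  · exact mul_nonpos_of_nonneg_of_nonpos (by positivity)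
      (Real.log_nonpos (gibbsZ_nonneg hB.le κ β h n) (hZ n))

lemma log_gibbsZ_le {B κ : ℝ} (hB : 1 < B) (hκ0 : 0 ≤ κ) (hκ : κ < 1 / 2) (β h : ℝ) (n : ℕ) :
    Real.log (gibbsZ B κ β h n) ≤ (|h| + β ^ 2 / 2 * corrBound κ) * 2 ^ n := by
  rw [Real.log_le_iff_le_exp (gibbsZ_pos hB κ β h), ← gwE_const hB.le (Real.exp _) n]
  refine gwE_mono hB.le fun t => Real.exp_le_exp.2 ?_
  rw [annealedH_eq]
  have hK : 0 ≤ corrBound κ := by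
    have : 0 < 1 - 2 * κ := by linarith
    rw [corrBound]; positivity
  have h1 := mul_le_mul_of_nonneg_left (pairSum_leaves_le hκ0 hκ t)
    (by positivity : 0 ≤ β ^ 2 / 2)
  have h2 := mul_le_mul_of_nonneg_right (le_abs_self h) (numLeaves_nonneg t)
  have h3 := mul_le_mul_of_nonneg_left (numLeaves_le t)
    (by positivity : 0 ≤ |h| + β ^ 2 / 2 * corrBound κ)
  linarith

lemma exists_gt_of_one_lt {B κ β h : ℝ} (hB : 1 < B) (hB2 : B < 2) (hκ : 0 ≤ κ) {n : ℕ}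
    (hn : 1 < gibbsZ B κ β h n) : ∃ m, B < gibbsZ B κ β h m := by
  have hB0 : 0 < B := by linarith
  set x := gibbsZ B κ β h n with hx
  have hgrow : ∀ k : ℕ, 1 + k * ((2 - B) / B * (x - 1)) ≤ gibbsZ B κ β h (n + k)
      ∧ x ≤ gibbsZ B κ β h (n + k) := by
    intro k
    induction k with
    | zero => simpa [← hx] using hn.le
    | succ k ih =>
      set z := gibbsZ B κ β h (n + k) with hz
      have h1 : z + (2 - B) / B * (x - 1) ≤ gibbsZ B κ β h (n + (k + 1)) := by
        refine le_trans ?_ (sq_add_le_gibbsZ_succ hB.le hκ β h (n + k))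
        rw [le_div_iff₀ hB0, ← hz]
        have e : (z + (2 - B) / B * (x - 1)) * B = z * B + (2 - B) * (x - 1) := by
          field_simp
        rw [e]
        nlinarith [ih.2, sq_nonneg (z - 1)]
      have h2 : 0 ≤ (2 - B) / B * (x - 1) :=
        mul_nonneg (div_nonneg (by linarith) hB0.le) (by linarith)
      push_cast
      exact ⟨by linarith [ih.1], by linarith [ih.2]⟩
  have hpos : 0 < (2 - B) / B * (x - 1) := mul_pos (div_pos (by linarith) hB0) (by linarith)
  obtain ⟨k, hk⟩ := exists_nat_gt (B / ((2 - B) / B * (x - 1)))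
  rw [div_lt_iff₀ hpos] at hk
  exact ⟨n + k, by linarith [(hgrow k).1]⟩

lemma exists_tendsto_freeEnergy_pos {B κ β h : ℝ} (hB : 1 < B) (hB2 : B < 2) (hκ0 : 0 ≤ κ)
    (hκ : κ < 1 / 2) {n : ℕ} (hn : 1 < gibbsZ B κ β h n) :
    ∃ f > 0, Tendsto (fun n : ℕ => 1 / 2 ^ n * Real.log (gibbsZ B κ β h n)) atTop (𝓝 f) := by
  have hB0 : 0 < B := by linarith
  set a : ℕ → ℝ := fun n => 1 / 2 ^ n * (Real.log (gibbsZ B κ β h n) - Real.log B) with ha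
  have hmono : Monotone a := by
    refine monotone_nat_of_le_succ fun n => ?_
    have hz := gibbsZ_pos hB κ β h (n := n)
    have h1 : gibbsZ B κ β h n ^ 2 / B ≤ gibbsZ B κ β h (n + 1) :=
      (div_le_div_of_nonneg_right (by linarith) hB0.le).trans
        (sq_add_le_gibbsZ_succ hB.le hκ0 β h n)
    have h2 := Real.log_le_log (by positivity) h1
    rw [Real.log_div (by positivity) hB0.ne', Real.log_pow] at h2
    push_cast at h2
    have h3 : a n = 1 / 2 ^ (n + 1) * (2 * (Real.log (gibbsZ B κ β h n) - Real.log B)) := by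
      simp only [ha]; rw [pow_succ]; field_simp
    rw [h3]
    exact mul_le_mul_of_nonneg_left (by linarith) (by positivity)
  have hbdd : BddAbove (Set.range a) := by
    refine ⟨|h| + β ^ 2 / 2 * corrBound κ, ?_⟩
    rintro _ ⟨n, rfl⟩
    have h1 := log_gibbsZ_le hB hκ0 hκ β h n
    have h2 := Real.log_nonneg hB.le
    simp only [ha]
    rw [one_div, inv_mul_le_iff₀ (by positivity)]
    linarith
  have hlim := tendsto_atTop_ciSup hmono hbdd
  obtain ⟨m, hm⟩ := exists_gt_of_one_lt hB hB2 hκ0 hn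
  have hpos : 0 < a m :=
    mul_pos (by positivity) (sub_pos.2 (Real.log_lt_log hB0 hm))
  refine ⟨⨆ i, a i, hpos.trans_le (le_ciSup hbdd m), ?_⟩
  have h4 := hlim.add (tendsto_one_div_two_pow.mul_const (Real.log B))
  rw [zero_mul, add_zero] at h4
  refine h4.congr fun n => ?_
  simp only [ha]
  ring

lemma IsHierDisorder.annealedF_eq_zero_iff {Ω : Type*} [MeasurableSpace Ω] {P : Measure Ω}
    {ω : ℕ → Ω → ℝ} {B κ : ℝ} (hω : IsHierDisorder κ P ω) (hB : 1 < B)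
    (hB2 : B < 2) (hκ0 : 0 ≤ κ) (hκ : κ < 1 / 2) (β h : ℝ) :
    annealedF P ω B β h = 0 ↔ ∀ n, gibbsZ B κ β h n ≤ 1 := by
  simp only [annealedF, hω.annealedZ_eq]
  constructor
  · intro hF
    by_contra! hne
    obtain ⟨n, hn⟩ := hne
    obtain ⟨f, hf, hlim⟩ := exists_tendsto_freeEnergy_pos hB hB2 hκ0 hκ hn
    exact hf.ne' (hlim.limUnder_eq.symm.trans hF)
  · exact fun hZ => (tendsto_freeEnergy_zero hB hκ0 hZ).limUnder_eq

lemma IsHierDisorder.isCritical_annealedHc {Ω : Type*} [MeasurableSpace Ω] {P : Measure Ω}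
    {ω : ℕ → Ω → ℝ} {B κ : ℝ} (hω : IsHierDisorder κ P ω) (hB : 1 < B)
    (hB2 : B < 2) (hκ0 : 0 ≤ κ) (hκ : κ < 1 / 2) (β : ℝ) :
    IsCritical B κ β (annealedHc P ω B β) := by
  have hset : {h : ℝ | annealedF P ω B β h = 0} = {h : ℝ | ∀ n, gibbsZ B κ β h n ≤ 1} := by
    ext h
    exact hω.annealedF_eq_zero_iff hB hB2 hκ0 hκ β h
  rw [annealedHc, hset]
  have hbdd : BddAbove {h : ℝ | ∀ n, gibbsZ B κ β h n ≤ 1} := by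
    refine ⟨0, fun h hh => ?_⟩
    have h1 : gibbsZ B κ β h 0 ≤ 1 := hh 0
    rw [gibbsZ_zero, Real.exp_le_one_iff] at h1
    nlinarith [sq_nonneg β]
  have hclosed : IsClosed {h : ℝ | ∀ n, gibbsZ B κ β h n ≤ 1} := by
    simp only [Set.ofPred_forall]
    exact isClosed_iInter fun n => isClosed_le (continuous_gibbsZ B κ β n) continuous_const
  have hne : {h : ℝ | ∀ n, gibbsZ B κ β h n ≤ 1}.Nonempty :=
    ⟨-(β ^ 2 / 2 * corrBound κ), gibbsZ_le_one_of_nonpos hB.le hκ0 hκ (by linarith)⟩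
  refine ⟨hclosed.csSup_mem hne hbdd, fun h' hh' => ?_⟩
  by_contra! hle
  exact (le_csSup hbdd hle).not_gt hh'

end HierPinning

theorem proposition3p2 (B κ : ℝ) (hB1 : 1 < B) (hB2 : B < 2) (hκ0 : 0 < κ)
    (hκ : κ < min (B ^ 2 / 4) (1 / 2)) :
    ∃ β₀ > (0 : ℝ), ∃ c₁ > (0 : ℝ), ∃ c₂ > (0 : ℝ),
      ∀ (Ω : Type*) [MeasurableSpace Ω] (P : Measure Ω) [IsProbabilityMeasure P]
        (ω : ℕ → Ω → ℝ), HierPinning.IsHierDisorder κ P ω →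
      ∀ β : ℝ, 0 ≤ β → β ≤ β₀ → ∀ n : ℕ,
        (∀ I : Finset ℕ, I ⊆ Finset.range (2 ^ n) → I.Nonempty →
          Real.exp (-c₁ * β ^ 2) ^ I.card
                * HierPinning.gwE B n (fun t => HierPinning.deltaProd t I)
              ≤ HierPinning.gwE B n (fun t => HierPinning.deltaProd t I
                  * Real.exp (HierPinning.annealedH κ β n (HierPinning.annealedHc P ω B β) t)) ∧
          HierPinning.gwE B n (fun t => HierPinning.deltaProd t I
                  * Real.exp (HierPinning.annealedH κ β n (HierPinning.annealedHc P ω B β) t))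
              ≤ Real.exp (c₁ * β ^ 2) ^ I.card
                * HierPinning.gwE B n (fun t => HierPinning.deltaProd t I)) ∧
        Real.exp (-c₂ * β ^ 2 * (4 * κ / B ^ 2) ^ n)
            ≤ HierPinning.annealedZ P ω B β n (HierPinning.annealedHc P ω B β) ∧
        HierPinning.annealedZ P ω B β n (HierPinning.annealedHc P ω B β) ≤ 1 := by
  open HierPinning in
  obtain ⟨hκB, hκ2⟩ := lt_min_iff.1 hκ
  have hθ : 4 * κ / B ^ 2 < 1 := by
    rw [div_lt_one (by positivity)]
    linarith
  obtain ⟨C, hC1, hC⟩ := exists_proxySum_le hB1.le hκ0.le hκ2 hθ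
  set θ := 4 * κ / B ^ 2 with hθd
  have hθ0 : 0 ≤ θ := by positivity
  have hθ1 : 0 < 1 - θ := by linarith
  set c := 4 / (1 - θ) with hcd
  have hc0 : 0 < c := by positivity
  have hK : 0 < corrBound κ := by
    have : 0 < 1 - 2 * κ := by linarith
    rw [corrBound]; positivity
  have hb0 : 0 < min (1 / (48 * C)) ((2 - B) / (2 * c)) :=
    lt_min (by positivity) (div_pos (by linarith) (by positivity))
  refine ⟨√(min (1 / (48 * C)) ((2 - B) / (2 * c))), Real.sqrt_pos.2 hb0,
    24 * C + corrBound κ + 2 * c / (1 - θ), by positivity, 2 * c, by positivity,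
    fun Ω _ P _ ω hω β hβ0 hβ n => ?_⟩
  have hβ2 : β ^ 2 ≤ min (1 / (48 * C)) ((2 - B) / (2 * c)) := by
    rw [← Real.sq_sqrt hb0.le]
    exact pow_le_pow_left₀ hβ0 hβ 2
  have hβC : β ^ 2 * C ≤ 1 / 48 := by
    have := hβ2.trans (min_le_left _ _)
    rw [le_div_iff₀ (by positivity)] at this
    linarith
  have hβc : c * β ^ 2 ≤ (2 - B) / 2 := by
    have := hβ2.trans (min_le_right _ _)
    rw [le_div_iff₀ (by positivity)] at this
    linarith
  have hcrit := hω.isCritical_annealedHc hB1 hB2 hκ0.le hκ2 β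
  set hc := annealedHc P ω B β
  have hlow : ∀ k, Real.exp (-(2 * c * β ^ 2 * θ ^ k)) ≤ gibbsZ B κ β hc k := fun k => by
    have hy1 : c * β ^ 2 * θ ^ k ≤ (2 - B) / 2 :=
      (mul_le_of_le_one_right (by positivity) (pow_le_one₀ hθ0 hθ.le)).trans hβc
    refine le_trans ?_ (hcrit.one_sub_le_gibbsZ hB1.le hκ0.le (by linarith) hθ hC hβC
      (by linarith) k)
    rw [← hθd, ← hcd]
    refine le_trans (le_of_eq ?_) (exp_neg_two_mul_le (y := c * β ^ 2 * θ ^ k) (by positivity)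
      (by linarith))
    ring_nf
  refine ⟨fun I hI hne => ⟨?_, ?_⟩, ?_, ?_⟩
  · have h0 : Real.exp (-(β ^ 2 / 2 * corrBound κ)) ≤ gibbsZ B κ β hc 0 := by
      rw [gibbsZ_zero]
      apply Real.exp_le_exp.2
      linarith [hcrit.ge hB1.le hκ0.le hκ2, sq_nonneg β]
    refine le_trans ?_ (le_gibbsW_of_le_gibbsZ hB1.le hκ0.le (by positivity : 0 ≤ 2 * c * β ^ 2)
      hθ0 h0 hlow n hI hne)
    refine mul_le_mul_of_nonneg_right ?_ (gwE_deltaProd_nonneg hB1.le I)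
    refine pow_le_pow_left₀ (Real.exp_pos _).le (Real.exp_le_exp.2 ?_) _
    have h1 : ∑ k ∈ Finset.range n, θ ^ k ≤ 1 / (1 - θ) := by
      rw [le_div_iff₀ hθ1, geom_sum_mul_neg]
      linarith [pow_nonneg hθ0 n]
    have h2 := mul_le_mul_of_nonneg_left h1 (by positivity : 0 ≤ 2 * c * β ^ 2)
    have h3 : 2 * c * β ^ 2 * (1 / (1 - θ)) = 2 * c / (1 - θ) * β ^ 2 := by ring
    have h4 : 0 ≤ C * β ^ 2 := by positivity
    have h5 : 0 ≤ corrBound κ * β ^ 2 := by positivity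
    linarith
  · refine (gibbsBound_of_gibbsZ_le_one hB1.le hκ0.le (by linarith) hC hβC n
      (fun k _ => hcrit.gibbsZ_le_one k) I hI).trans ?_
    refine mul_le_mul_of_nonneg_right ?_ (gwE_deltaProd_nonneg hB1.le I)
    refine pow_le_pow_left₀ (Real.exp_pos _).le (Real.exp_le_exp.2 ?_) _
    have h1 := mul_le_mul_of_nonneg_left (hC n) (sq_nonneg β)
    have h2 : 0 ≤ 2 * c / (1 - θ) * β ^ 2 := by positivity
    have h5 : 0 ≤ corrBound κ * β ^ 2 := by positivity
    linarith
  · rw [hω.annealedZ_eq]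
    refine le_trans (le_of_eq ?_) (hlow n)
    ring_nf
  · rw [hω.annealedZ_eq]
    exact hcrit.gibbsZ_le_one n
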